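/- **Setting.** Let $2\le r<\infty$ and let $\mathcal A_r$ be the real Cayley–Dickson algebra of dimension $2^r$ obtained from $\mathbf R$ by $r$ doublings $(a,b)(c,d)=(ac-\tilde d b,\,da+b\tilde c)$, $\widetilde{(a,b)}=(\tilde a,-b)$, with unit $i_0=1$ and Euclidean norm $|\cdot|$. Let $\mathcal A_{r,C}=\mathcal A_r\oplus \mathbf i\mathcal A_r$ be its complexification ($\mathbf i$ central, $\mathbf i^2=-1$), and $\|z\|^2=\sum_j (2|b_j|^2+2|c_j|^2)$ for $z=(b_j+\mathbf i c_j)_j\in\mathcal A_{r,C}^h$. Let $L_r(\mathcal A_{r,C}^n,\mathcal A_{r,C}^h)$ be the space of $\mathbf R$-linear operators $J$ with $J(xb+yc)=(Jx)b+(Jy)c$ for $x,y\in\mathbf R^n=i_0\mathbf R^n$ and $b,c\in\mathcal A_{r,C}$, and let $L_{r,i}$ be the set of those with $J(\mathcal A_r^n)\subset\mathcal A_r^h$. Let $T=[0,s]$ ($0<s<\infty$) or $T=[0,\infty)$, let $(\Omega,\mathcal F,\mathsf P)$ be a probability space and $\{\mathcal F_t\}_{t\in T}$ a normal filtration: $\mathcal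 F_0$ contains the $\mathsf P$-null events and $\mathcal F_t=\bigcap_{v\in T,\,v>t}\mathcal F_v$ for every $t\in T$ that is not the right end point of $T$. A random function $u(t,\omega)$ on $T\times\Omega$ is *predictable* if it is measurable for the completion, by the null sets of $\lambda\times\mathsf P$ ($\lambda$ Lebesgue measure), of the $\sigma$-algebra generated by the sets $(v,t]\times A$ with $A\in\mathcal F_v$ and $\{0\}\times A$ with $A\in\mathcal F_0$. For $k=0,1$ let $U_k=\bigoplus_j a_{k,j}B_{k,j}$ and $U_k^{1/2}=\bigoplus_j a_{k,j}^{1/2}B_{k,j}^{1/2}$ be in $L_{r,i}(\mathcal A_{r,C}^n,\mathcal A_{r,C}^n)$, with $a_{k,j}\in\mathcal A_r$, with $a_{k,j}^{1/2}\in\mathcal A_r$ a square root of $a_{k,j}$, and with real positive definite matrices $B_{k,j}$. Let $w=w_0+\mathbf i w_1$ be an $\mathcal A_{r,C}^n$-valued random function on $T$ such that $w_0$ and $w_1$ are independent, $\mathcal A_r^n$-valued, and $w_k$ is a $U_k$-random function: $w_k(0)=0$ a.s., $w_k$ has independent increments, and for $s<t$ the increment $w_k(t)-w_k(s)$ has the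 law of $U_k^{1/2}\xi$ with $\xi$ a centred Gaussian vector in $\mathbf R^n$ with covariance $(t-s)I$. Assume that $w$ is adapted to $\{\mathcal F_t\}$ and that $w(t)-w(s)$ is independent of $\mathcal F_s$ for $s<t$. For $S\in L_r(\mathcal A_{r,C}^n,\mathcal A_{r,C}^h)$ write $S(x+\mathbf i y)=S_{0,0}x+S_{0,1}y+\mathbf i(S_{1,0}x)+\mathbf i(S_{1,1}y)$ for $x,y\in\mathcal A_r^n$, with $S_{l,k}:\mathcal A_r^n\to\mathcal A_r^h$, and put $$F(S;U_0,U_1)=\sum_{l,k=0}^1 \mathrm{Tr}\big(\{S_{l,k}U_k^{1/2}\}\{S_{l,k}U_k^{1/2}\}^*\big),\qquad \mathrm{Tr}(QQ^*)=\sum_{k=1}^n|Qe_k|^2,$$ $e_1,\dots,e_n$ being the standard basis of $\mathbf R^n$. Let $0\le a<b$ in $T$. The class $V_{2,1}(U_0,U_1,a,b,n,h)$ consists of the predictable $L_r(\mathcal A_{r,C}^n,\mathcal A_{r,C}^h)$-valued random functions $S$ on $T$ with $E\int_a^bF(S(\tau);U_0,U_1)\,d\tau<\infty$. An elementary random function is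 $S=\sum_l S_l\,\mathrm{ch}_{(t_l,t_{l+1}]}$ with finitely many $0=t_0<t_1<\dots$ in $T$ and $\mathcal F_{t_l}$-measurable $L_r$-valued $S_l$; for it $\int_0^tS\,dw=\sum_lS_l\big(w(t_{l+1}\wedge t)-w(t_l\wedge t)\big)$ and $\int_a^b S\,dw=\int_0^bS\,dw-\int_0^aS\,dw$. For $S\in V_{2,1}(U_0,U_1,a,b,n,h)$ the integral $\int_a^bS\,dw$ is the mean square limit (in $E\|\cdot\|^2$) of $\int_a^bS_\kappa\,dw$, where the $S_\kappa$ are elementary with $E\int_a^bF(S-S_\kappa;U_0,U_1)\,d\tau\to0$; and, for $t\in[a,b]$, $\int_a^tS\,dw:=\int_a^bS(\tau)\,\mathrm{ch}_{[0,\infty)}(t-\tau)\,dw(\tau)$. **Theorem 2.27.** Under these assumptions let $S\in V_{2,1}(U_0,U_1,a,b,n,h)$. Then for every $t\in[a,b]$ the integral $\eta(t)=\int_a^tS(\tau)\,dw(\tau)$ exists, and, whatever versions of these random variables are chosen, the random function $\eta$ is stochastically continuous on $[a,b]$: for all $t_0\in[a,b]$ and $\varepsilon>0$, $$\mathsf P\{\|\eta(t)-\eta(t_0)\|>\varepsilon\}\to0\quad\text{as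 } t\to t_0,\ t\in[a,b].$$ -/

import Mathlib

open MeasureTheory ProbabilityTheory Filter Set
open scoped ENNReal NNReal Topology

noncomputable section

namespace CDStoch

/-! ### The Cayley-Dickson algebras and their complexifications -/

/-- The real vector space underlying the Cayley-Dickson algebra `𝒜_r` of dimension `2 ^ r`.
The coordinates with respect to the standard basis are indexed by binary words of length `r`. -/
abbrev CD (r : ℕ) : Type := (Fin r → Bool) → ℝ

namespace CD

/-- The component `a` of `(a, b)` in `𝒜_{r+1} = 𝒜_r ⊕ 𝒜_r l`. -/
def left {r : ℕ} (x : CD (r + 1)) : CD r := fun s => x (Fin.cons false s)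

/-- The component `b` of `(a, b)` in `𝒜_{r+1} = 𝒜_r ⊕ 𝒜_r l`. -/
def right {r : ℕ} (x : CD (r + 1)) : CD r := fun s => x (Fin.cons true s)

/-- The pair `(a, b)` in `𝒜_{r+1} = 𝒜_r ⊕ 𝒜_r l`. -/
def join {r : ℕ} (a b : CD r) : CD (r + 1) :=
  fun s => if s 0 = true then b (Fin.tail s) else a (Fin.tail s)

/-- Conjugation, `(a, b)~ = (a~, -b)`. -/
def conj : (r : ℕ) → CD r → CD r
  | 0, x => x
  | r + 1, x => join (conj r (left x)) (-right x)

/-- The doubling procedure, `(a, b) (c, d) = (a c - d~ b, d a + b c~)`. -/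
def mul : (r : ℕ) → CD r → CD r → CD r
  | 0, x, y => fun s => x s * y s
  | r + 1, x, y =>
      join (mul r (left x) (left y) - mul r (conj r (right y)) (right x))
        (mul r (right y) (left x) + mul r (right x) (conj r (left y)))

/-- The unit `i_0 = 1`. -/
def one (r : ℕ) : CD r := Pi.single (fun _ => false) 1

/-- `|x| ^ 2`, the sum of the squares of the coordinates. -/
def normSq {r : ℕ} (x : CD r) : ℝ := ∑ s, x s ^ 2

theorem left_add {r : ℕ} (x y : CD (r + 1)) : left (x + y) = left x + left y := rfl

theorem right_add {r : ℕ} (x y : CD (r + 1)) : right (x + y) = right x + right y := rfl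

theorem left_smul {r : ℕ} (c : ℝ) (x : CD (r + 1)) : left (c • x) = c • left x := rfl

theorem right_smul {r : ℕ} (c : ℝ) (x : CD (r + 1)) : right (c • x) = c • right x := rfl

theorem join_add {r : ℕ} (a b c d : CD r) : join (a + c) (b + d) = join a b + join c d := by
  funext s
  by_cases hs : s 0 = true <;> simp [join, hs]

theorem join_smul {r : ℕ} (t : ℝ) (a b : CD r) : join (t • a) (t • b) = t • join a b := by
  funext s
  by_cases hs : s 0 = true <;> simp [join, hs]

theorem conj_add : ∀ (r : ℕ) (x y : CD r), conj r (x + y) = conj r x + conj r y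
  | 0, _, _ => rfl
  | r + 1, x, y => by
      simp only [conj, left_add, right_add, conj_add r, neg_add, join_add]

theorem conj_smul : ∀ (r : ℕ) (c : ℝ) (x : CD r), conj r (c • x) = c • conj r x
  | 0, _, _ => rfl
  | r + 1, c, x => by
      rw [conj, conj, left_smul, right_smul, conj_smul r, ← smul_neg, join_smul]

theorem mul_add' : ∀ (r : ℕ), (∀ x y z : CD r, mul r (x + y) z = mul r x z + mul r y z) ∧
    (∀ x y z : CD r, mul r z (x + y) = mul r z x + mul r z y)
  | 0 => ⟨fun x y z => by funext s; simp [mul, add_mul], fun x y z => by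
      funext s; simp [mul, mul_add]⟩
  | r + 1 => by
      obtain ⟨h1, h2⟩ := mul_add' r
      constructor <;> intro x y z <;>
        simp only [mul, left_add, right_add, conj_add, h1, h2] <;> rw [← join_add] <;>
        congr 1 <;> abel

theorem mul_smul' : ∀ (r : ℕ), (∀ (c : ℝ) (x y : CD r), mul r (c • x) y = c • mul r x y) ∧
    (∀ (c : ℝ) (x y : CD r), mul r x (c • y) = c • mul r x y)
  | 0 => ⟨fun c x y => by funext s; simp [mul, mul_assoc], fun c x y => by
      funext s; simp [mul, mul_left_comm]⟩
  | r + 1 => by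
      obtain ⟨h1, h2⟩ := mul_smul' r
      constructor <;> intro c x y <;>
        simp only [mul, left_smul, right_smul, conj_smul, h1, h2] <;> rw [← join_smul] <;>
        congr 1 <;> module

end CD

/-- The complexified algebra `𝒜_{r,C} = 𝒜_r ⊕ 𝐢 𝒜_r`; the pair `(b, c)` is `b + 𝐢 c`. -/
abbrev CDC (r : ℕ) : Type := CD r × CD r

namespace CDC

/-- `(b + 𝐢 c) (b' + 𝐢 c') = (b b' - c c') + 𝐢 (b c' + c b')`: here `𝐢` is central and
`𝐢 ^ 2 = -1`. -/
def mul {r : ℕ} (x y : CDC r) : CDC r :=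
  (CD.mul r x.1 y.1 - CD.mul r x.2 y.2, CD.mul r x.1 y.2 + CD.mul r x.2 y.1)

/-- The unit of `𝒜_{r,C}`. -/
def one (r : ℕ) : CDC r := (CD.one r, 0)

theorem add_mul' {r : ℕ} (x y z : CDC r) : mul (x + y) z = mul x z + mul y z := by
  have h := (CD.mul_add' r).1
  simp only [mul, Prod.fst_add, Prod.snd_add, h, Prod.mk_add_mk]
  congr 1 <;> abel

theorem smul_mul' {r : ℕ} (c : ℝ) (x z : CDC r) : mul (c • x) z = c • mul x z := by
  have h := (CD.mul_smul' r).1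
  simp only [mul, Prod.smul_fst, Prod.smul_snd, h, Prod.smul_mk]
  congr 1 <;> module

end CDC

/-- The module `𝒜_{r,C} ^ n`. -/
abbrev CDCVec (r n : ℕ) : Type := Fin n → CDC r

/-- The square of the norm of `𝒜_{r,C} ^ h`:
`‖z‖ ^ 2 = ∑ j, ‖z_j‖ ^ 2` with `‖b + 𝐢 c‖ ^ 2 = 2 |b| ^ 2 + 2 |c| ^ 2`. -/
def vecNormSq {r h : ℕ} (z : CDCVec r h) : ℝ :=
  ∑ j, (2 * CD.normSq (z j).1 + 2 * CD.normSq (z j).2)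

/-- The norm of `𝒜_{r,C} ^ h`. -/
def vecNorm {r h : ℕ} (z : CDCVec r h) : ℝ := Real.sqrt (vecNormSq z)

/-- The embedding of `ℝ ^ n` into `𝒜_{r,C} ^ n` as `ℝ ^ n i_0`. -/
def realEmb (r : ℕ) {n : ℕ} (x : Fin n → ℝ) : CDCVec r n := fun k => x k • CDC.one r

/-- The embedding `x ↦ x` (for `l = 0`) or `x ↦ 𝐢 x` (for `l = 1`) of `𝒜_r ^ n` into
`𝒜_{r,C} ^ n`. -/
def embI {r n : ℕ} (l : Fin 2) (x : Fin n → CD r) : CDCVec r n :=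
  fun k => if l = 0 then (x k, 0) else (0, x k)

/-- The components `x` (for `l = 0`) and `y` (for `l = 1`) of `x + 𝐢 y`. -/
def compI {r n : ℕ} (l : Fin 2) (z : CDCVec r n) : Fin n → CD r :=
  fun k => if l = 0 then (z k).1 else (z k).2

/-- Componentwise right multiplication by a scalar. -/
def vecMulRight {r n : ℕ} (z : CDCVec r n) (b : CDC r) : CDCVec r n := fun k => CDC.mul (z k) b

/-! ### Operators -/

/-- The space `L_r(𝒜_{r,C} ^ n, 𝒜_{r,C} ^ h)` of operators that are right `𝒜_{r,C}`-linear
in the weak sense: `J (x b + y c) = (J x) b + (J y) c` for `x, y ∈ ℝ ^ n`, `b, c ∈ 𝒜_{r,C}`. -/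
def Lr (r n h : ℕ) : Submodule ℝ (CDCVec r n →L[ℝ] CDCVec r h) where
  carrier := {J | ∀ (x y : Fin n → ℝ) (b c : CDC r),
    J (vecMulRight (realEmb r x) b + vecMulRight (realEmb r y) c) =
      vecMulRight (J (realEmb r x)) b + vecMulRight (J (realEmb r y)) c}
  add_mem' := by
    intro J K hJ hK x y b c
    simp only [mem_ofPred_eq] at hJ hK
    simp only [add_apply, hJ, hK]
    funext k
    simp only [vecMulRight, Pi.add_apply, CDC.add_mul']
    abel
  zero_mem' := by
    intro x y b c
    have h0 : CDC.mul (0 : CDC r) b = 0 ∧ CDC.mul (0 : CDC r) c = 0 := by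
      constructor
      · simpa using CDC.smul_mul' 0 (0 : CDC r) b
      · simpa using CDC.smul_mul' 0 (0 : CDC r) c
    funext k
    simp [vecMulRight, h0.1, h0.2]
  smul_mem' := by
    intro t J hJ x y b c
    simp only [mem_ofPred_eq] at hJ
    simp only [smul_apply, hJ]
    funext k
    simp only [vecMulRight, Pi.add_apply, Pi.smul_apply, CDC.smul_mul', smul_add]

/-- The operator `J` belongs to `L_{r,i}(𝒜_{r,C} ^ n, 𝒜_{r,C} ^ h)`: moreover
`J (𝒜_r ^ n) ⊆ 𝒜_r ^ h`. -/
def IsLri {r n h : ℕ} (J : Lr r n h) : Prop :=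
  ∀ x : Fin n → CD r, ∀ l, (J.1 (embI 0 x) l).2 = 0

/-- `U = a_1 B_1 ⊕ ... ⊕ a_m B_m` and `V = U^{1/2} = a_1^{1/2} B_1^{1/2} ⊕ ... ⊕ a_m^{1/2} B_m^{1/2}`,
both in `L_{r,i}(𝒜_{r,C} ^ n, 𝒜_{r,C} ^ n)`, where `a_j ∈ 𝒜_r`, `c_j = a_j^{1/2} ∈ 𝒜_r` is a square
root of `a_j`, and the `B_j` are real positive definite matrices.
The index `p k` is the number of the block that contains the coordinate `k`, the matrix `B` is the
direct sum of the `B_j`, and `R` is the positive definite square root of `B`. -/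
def IsCovarianceWithRoot {r n : ℕ} (U V : Lr r n n) : Prop :=
  IsLri U ∧ IsLri V ∧
  ∃ (m : ℕ) (p : Fin n → Fin m) (a c : Fin m → CD r) (B R : Matrix (Fin n) (Fin n) ℝ),
    (∀ j, CD.mul r (c j) (c j) = a j) ∧
    B.PosDef ∧ R.PosDef ∧ R * R = B ∧
    (∀ k l, p k ≠ p l → B k l = 0) ∧ (∀ k l, p k ≠ p l → R k l = 0) ∧
    (∀ k l, U.1 (realEmb r (Pi.single l 1)) k = (B k l • a (p k), 0)) ∧
    (∀ k l, V.1 (realEmb r (Pi.single l 1)) k = (R k l • c (p k), 0))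

/-- `Tr (Q Q*) = ∑ k, |Q e_k| ^ 2 = ∑ k, ∑ l, |⟨f_l, Q e_k⟩| ^ 2` for a map
`Q : 𝒜_r ^ n → 𝒜_r ^ h`, where `e_k`, `f_l` are the standard bases of `ℝ ^ n`, `ℝ ^ h`. -/
def traceSq {r n h : ℕ} (Q : (Fin n → CD r) → (Fin h → CD r)) : ℝ :=
  ∑ k : Fin n, ∑ l : Fin h, CD.normSq (Q (Pi.single k (CD.one r)) l)

/-- The components `S_{l,k}` of `S`, as maps `𝒜_r ^ n → 𝒜_r ^ h`:
`S (x + 𝐢 y) = S_{0,0} x + S_{0,1} y + 𝐢 (S_{1,0} x) + 𝐢 (S_{1,1} y)`. -/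
def opComp {r n h : ℕ} (S : Lr r n h) (l k : Fin 2) (x : Fin n → CD r) : Fin h → CD r :=
  compI l (S.1 (embI k x))

/-- `F(S; U_0, U_1) = ∑_{l,k} Tr ((S_{l,k} U_k^{1/2}) (S_{l,k} U_k^{1/2})*)`, where `V k` is
`U_k^{1/2}`. -/
def FForm {r n h : ℕ} (V : Fin 2 → Lr r n n) (S : Lr r n h) : ℝ :=
  ∑ l : Fin 2, ∑ k : Fin 2, traceSq (fun x => opComp S l k (compI 0 ((V k).1 (embI 0 x))))

/-! ### Filtrations and predictable random functions -/

section Processes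

variable {Ω : Type*} {mΩ : MeasurableSpace Ω} {T : Set ℝ}

/-- A normal filtration: `𝓕_0` contains the null events, and `𝓕_t` is the intersection of the
`𝓕_v` with `v > t` (for `t` not the right end point of `T`). -/
structure IsNormalFiltration (𝓕 : Filtration T mΩ) (P : Measure Ω) : Prop where
  null_mem : ∀ z : T, (z : ℝ) = 0 → ∀ A, MeasurableSet A → P A = 0 → MeasurableSet[𝓕 z] A
  right_cont : ∀ t : T, (∃ v : T, t < v) →
    ∀ A, (∀ v : T, t < v → MeasurableSet[𝓕 v] A) → MeasurableSet[𝓕 t] A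

/-- The `σ`-algebra on `T × Ω` generated by the sets `(v, t] × A` with `A ∈ 𝓕_v` and `{0} × A`
with `A ∈ 𝓕_0`. -/
@[reducible]
def predSigma (𝓕 : Filtration T mΩ) : MeasurableSpace (T × Ω) :=
  MeasurableSpace.generateFrom
    ({D | ∃ (v t : T) (A : Set Ω), v < t ∧ MeasurableSet[𝓕 v] A ∧ D = Ioc v t ×ˢ A} ∪
     {D | ∃ (z : T) (A : Set Ω), (z : ℝ) = 0 ∧ MeasurableSet[𝓕 z] A ∧ D = {z} ×ˢ A})

theorem predSigma_le (𝓕 : Filtration T mΩ) : predSigma 𝓕 ≤ Prod.instMeasurableSpace := by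
  refine MeasurableSpace.generateFrom_le ?_
  rintro D (⟨v, t, A, -, hA, rfl⟩ | ⟨z, A, -, hA, rfl⟩)
  · exact measurableSet_Ioc.prod (𝓕.le v A hA)
  · exact (measurableSet_singleton z).prod (𝓕.le z A hA)

/-- Lebesgue measure on `T`. -/
def timeMeasure (T : Set ℝ) : Measure T := (volume : Measure ℝ).comap Subtype.val

/-- Predictable random functions: `u` is measurable for the completion of the predictable
`σ`-algebra by the null sets of the product of Lebesgue measure and `P`. -/
def IsPredictable {X : Type*} [MeasurableSpace X] (𝓕 : Filtration T mΩ) (P : Measure Ω)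
    (u : T → Ω → X) : Prop :=
  @NullMeasurable (T × Ω) X (predSigma 𝓕) _ (fun q => u q.1 q.2)
    (((timeMeasure T).prod P).trim (predSigma_le 𝓕))

/-! ### The driving random function -/

/-- `w` is a `U`-random function with values in `𝒜_r ^ n`, where `V = U^{1/2}`: it vanishes at `0`,
it has independent increments, and `w(t) - w(s)` has the law of `U^{1/2} ξ`, where `ξ` is a centred
Gaussian vector in `ℝ ^ n` with covariance matrix `(t - s) I`. -/
structure IsURandomFunction {r n : ℕ} (P : Measure Ω) (V : Lr r n n)
    (w : T → Ω → Fin n → CD r) : Prop where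
  measurable : ∀ t, Measurable (w t)
  zero : ∀ z : T, (z : ℝ) = 0 → ∀ᵐ ω ∂P, w z ω = 0
  indep : HasIndepIncrements w P
  law : ∀ s t : T, s < t →
    P.map (fun ω => w t ω - w s ω) =
      (Measure.pi (fun _ : Fin n => gaussianReal 0 (Real.toNNReal ((t : ℝ) - s)))).map
        (fun ξ => compI 0 (V.1 (realEmb r ξ)))

/-- `w = w_0 + 𝐢 w_1`, where `w_k` is a `U_k`-random function with values in `𝒜_r ^ n` (and
`V k = U_k^{1/2}`), `w_0` and `w_1` are independent, `w` is adapted to `𝓕`, and the increments of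
`w` after the time `s` are independent of `𝓕_s`. -/
structure IsDrivingFunction {r n : ℕ} (P : Measure Ω) (𝓕 : Filtration T mΩ)
    (U V : Fin 2 → Lr r n n) (w : T → Ω → CDCVec r n) : Prop where
  root : ∀ k, IsCovarianceWithRoot (U k) (V k)
  comp : ∀ k, IsURandomFunction P (V k) (fun t ω => compI k (w t ω))
  indep_comp : IndepFun (fun ω t => compI 0 (w t ω)) (fun ω t => compI 1 (w t ω)) P
  adapted : ∀ t, Measurable[𝓕 t] (w t)
  indep_past : ∀ s t : T, s < t →
    Indep (MeasurableSpace.comap (fun ω => w t ω - w s ω) inferInstance) (𝓕 s) P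

/-! ### The stochastic integral -/

/-- An elementary `L_r`-valued random function `∑ l, S_l ch_{(t_l, t_{l+1}]}`, where
`0 = t_0 < ... < t_k` and `S_l` is `𝓕_{t_l}`-measurable. -/
structure Elementary (𝓕 : Filtration T mΩ) (r n h : ℕ) where
  k : ℕ
  time : Fin (k + 1) → T
  time_zero : (time 0 : ℝ) = 0
  strictMono : StrictMono time
  val : Fin k → Ω → Lr r n h
  measurable_val : ∀ l, Measurable[𝓕 (time l.castSucc)] (val l)

namespace Elementary

variable {𝓕 : Filtration T mΩ} {r n h : ℕ}

open Classical in
/-- The values of an elementary random function. -/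
def eval (S : Elementary 𝓕 r n h) (τ : T) (ω : Ω) : Lr r n h :=
  ∑ l : Fin S.k, if S.time l.castSucc < τ ∧ τ ≤ S.time l.succ then S.val l ω else 0

/-- `∫_0^t S dw = ∑ l, S_l (w(t_{l+1} ∧ t) - w(t_l ∧ t))`. -/
def integralZero (S : Elementary 𝓕 r n h) (w : T → Ω → CDCVec r n) (t : T) (ω : Ω) :
    CDCVec r h :=
  ∑ l : Fin S.k,
    (S.val l ω).1 (w (min (S.time l.succ) t) ω - w (min (S.time l.castSucc) t) ω)

/-- `∫_a^b S dw = ∫_0^b S dw - ∫_0^a S dw`. -/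
def integral (S : Elementary 𝓕 r n h) (w : T → Ω → CDCVec r n) (a b : T) (ω : Ω) :
    CDCVec r h :=
  S.integralZero w b ω - S.integralZero w a ω

end Elementary

/-- `E ∫_a^b F(S; U_0, U_1)(τ) dτ`, as an element of `[0, ∞]`. -/
def energy {r n h : ℕ} (P : Measure Ω) (V : Fin 2 → Lr r n n) (a b : T)
    (S : T → Ω → Lr r n h) : ℝ≥0∞ :=
  ∫⁻ ω, ∫⁻ τ in Icc a b, ENNReal.ofReal (FForm V (S τ ω)) ∂(timeMeasure T) ∂P

/-- The class `V_{2,1}(U_0, U_1, a, b, n, h)`: the predictable `L_r`-valued random functions with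
`E ∫_a^b F(S; U_0, U_1)(τ) dτ < ∞`. -/
structure MemV21 {r n h : ℕ} (P : Measure Ω) (𝓕 : Filtration T mΩ) (V : Fin 2 → Lr r n n)
    (a b : T) (S : T → Ω → Lr r n h) : Prop where
  predictable : IsPredictable 𝓕 P S
  energy_lt_top : energy P V a b S < ∞

/-- The random variable `I` is (a version of) `∫_a^b S dw`: it is the mean square limit of the
integrals of some elementary random functions `S_κ` with `E ∫_a^b F(S - S_κ; U_0, U_1) dτ → 0`. -/
def IsStochIntegral {r n h : ℕ} (P : Measure Ω) (𝓕 : Filtration T mΩ) (V : Fin 2 → Lr r n n)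
    (w : T → Ω → CDCVec r n) (a b : T) (S : T → Ω → Lr r n h) (I : Ω → CDCVec r h) : Prop :=
  Measurable I ∧ ∃ Sκ : ℕ → Elementary 𝓕 r n h,
    Tendsto (fun κ => energy P V a b (fun τ ω => S τ ω - (Sκ κ).eval τ ω)) atTop (𝓝 0) ∧
    Tendsto (fun κ => ∫⁻ ω, ENNReal.ofReal (vecNormSq ((Sκ κ).integral w a b ω - I ω)) ∂P)
      atTop (𝓝 0)

open Classical in
/-- The random variable `I` is (a version of) the value at `t ∈ [a, b]` of the indefinite integral,
`∫_a^t S dw = ∫_a^b S(τ) ch_{[0, ∞)}(t - τ) dw(τ)`. -/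
def IsIndefiniteIntegral {r n h : ℕ} (P : Measure Ω) (𝓕 : Filtration T mΩ)
    (V : Fin 2 → Lr r n n) (w : T → Ω → CDCVec r n) (a b : T) (S : T → Ω → Lr r n h) (t : T)
    (I : Ω → CDCVec r h) : Prop :=
  IsStochIntegral P 𝓕 V w a b (fun τ ω => if τ ≤ t then S τ ω else 0) I

/-- Stochastic continuity on `[a, b]`. -/
def IsStochContinuousOn {r h : ℕ} (P : Measure Ω) (a b : T) (η : T → Ω → CDCVec r h) : Prop :=
  ∀ t₀ ∈ Icc a b, ∀ ε : ℝ, 0 < ε →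
    Tendsto (fun t => P {ω | ε < vecNorm (η t ω - η t₀ ω)}) (𝓝[Icc a b] t₀) (𝓝 0)

end Processes

end CDStoch

end

noncomputable section

namespace CDStoch

/-! ### The quadratic forms `vecNormSq` and `FForm` -/

section Forms

variable {r n h : ℕ}

/-! The whole proof rests on an Itô isometry: for an elementary `E`, the mean of `vecNormSq` of
`∫_a^b E dw` equals twice the energy of `E`. In real coordinates, `2 * FForm V S` is the sum of the
squared norms of the columns `S U_0^{1/2} e_j` and `S 𝐢 U_1^{1/2} e_j` (`two_mul_FForm`), which is
also, per unit time, the second moment of `S` applied to an increment of `w`, since that increment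
is the image of two independent standard Gaussian vectors. An increment after time `s` is
independent of `𝓕_s`, so in a sum of steps the past acts as a constant and the cross terms vanish
(`lintegral_vecNormSq_step`, `lintegral_vecNormSq_sum`). All identities are between integrals in
`[0, ∞]`, so no integrability has to be known beforehand.

Existence: elementary functions are dense in `V_{2,1}` for the energy
(`MemV21.exists_elementary_energy_le`). A predictable function of finite energy is truncated, and a
bounded predictable function is approximated in `L^2` by a Dynkin argument on the generating
rectangles. The isometry turns an energy-Cauchy sequence of integrands into an `L^2`-Cauchy sequence
of integrals, and `L^2` is complete. Cutting the integrand off after `t` preserves `V_{2,1}`, which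
gives the indefinite integral.

Continuity: passing to the limit in the isometry, the mean square distance of any versions of two
integrals is at most a constant times the energy of the difference of the integrands
(`IsStochIntegral.lintegral_vecNormSq_sub_le`). For `η t` and `η t₀` that energy is at most the
integral of `FForm V S` over a strip of width `|t - t₀|`. It tends to zero by absolute continuity of
the integral, and Chebyshev's inequality concludes. -/

theorem vecNormSq_eq_sum (z : CDCVec r h) :
    vecNormSq z = ∑ j, ((∑ s, 2 * (z j).1 s ^ 2) + ∑ s, 2 * (z j).2 s ^ 2) := by
  simp only [vecNormSq, CD.normSq, Finset.mul_sum]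

theorem vecNormSq_nonneg (z : CDCVec r h) : 0 ≤ vecNormSq z := by
  rw [vecNormSq_eq_sum]; positivity

theorem continuous_vecNormSq : Continuous (vecNormSq : CDCVec r h → ℝ) := by
  unfold vecNormSq CD.normSq
  fun_prop

theorem vecNormSq_zero : vecNormSq (0 : CDCVec r h) = 0 := by
  simp [vecNormSq_eq_sum]

theorem vecNormSq_neg (z : CDCVec r h) : vecNormSq (-z) = vecNormSq z := by
  simp [vecNormSq_eq_sum]

theorem vecNormSq_add_le (x y : CDCVec r h) :
    vecNormSq (x + y) ≤ 2 * vecNormSq x + 2 * vecNormSq y := by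
  have key : ∀ a b : ℝ, 2 * (a + b) ^ 2 ≤ 2 * (2 * a ^ 2) + 2 * (2 * b ^ 2) := fun a b => by
    nlinarith [sq_nonneg (a - b)]
  simp only [vecNormSq_eq_sum, Finset.mul_sum, mul_add, ← Finset.sum_add_distrib]
  refine Finset.sum_le_sum fun j _ => ?_
  refine Finset.sum_le_sum fun s _ => ?_
  have h1 := key ((x j).1 s) ((y j).1 s)
  have h2 := key ((x j).2 s) ((y j).2 s)
  simp only [Pi.add_apply, Prod.fst_add, Prod.snd_add]
  linarith

theorem vecNormSq_sub_le (x y : CDCVec r h) :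
    vecNormSq (x - y) ≤ 2 * vecNormSq x + 2 * vecNormSq y := by
  rw [sub_eq_add_neg, ← vecNormSq_neg y]
  exact vecNormSq_add_le _ _

/-- The ambient norm of `CDCVec r h` is a supremum norm. This bound and the converse one in
`exists_vecNormSq_le` make it equivalent to the Euclidean norm, so that completeness of `L^2` can be
applied to `vecNormSq`. -/
theorem norm_sq_le_vecNormSq (z : CDCVec r h) : ‖z‖ ^ 2 ≤ vecNormSq z := by
  have key : ‖z‖ ≤ Real.sqrt (vecNormSq z) := by
    have hj : ∀ j, (∑ s, 2 * (z j).1 s ^ 2) + ∑ s, 2 * (z j).2 s ^ 2 ≤ vecNormSq z := fun j => by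
      rw [vecNormSq_eq_sum]
      exact Finset.single_le_sum
        (f := fun j => (∑ s, 2 * (z j).1 s ^ 2) + ∑ s, 2 * (z j).2 s ^ 2)
        (fun _ _ => by positivity) (Finset.mem_univ j)
    refine (pi_norm_le_iff_of_nonneg (Real.sqrt_nonneg _)).2 fun j => ?_
    have h1 : 0 ≤ ∑ s, 2 * (z j).1 s ^ 2 := by positivity
    have h2 : 0 ≤ ∑ s, 2 * (z j).2 s ^ 2 := by positivity
    refine max_le ?_ ?_ <;>
      refine (pi_norm_le_iff_of_nonneg (Real.sqrt_nonneg _)).2 fun s => Real.abs_le_sqrt ?_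
    · have := Finset.single_le_sum (f := fun s => 2 * (z j).1 s ^ 2)
        (fun _ _ => by positivity) (Finset.mem_univ s)
      nlinarith [hj j, sq_nonneg ((z j).1 s)]
    · have := Finset.single_le_sum (f := fun s => 2 * (z j).2 s ^ 2)
        (fun _ _ => by positivity) (Finset.mem_univ s)
      nlinarith [hj j, sq_nonneg ((z j).2 s)]
  calc ‖z‖ ^ 2 ≤ Real.sqrt (vecNormSq z) ^ 2 := by gcongr
    _ = _ := Real.sq_sqrt (vecNormSq_nonneg z)

theorem exists_vecNormSq_le (r h : ℕ) :
    ∃ C : ℝ, 0 ≤ C ∧ ∀ z : CDCVec r h, vecNormSq z ≤ C * ‖z‖ ^ 2 := by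
  refine ⟨∑ _j : Fin h, ((∑ _s : Fin r → Bool, 2) + ∑ _s : Fin r → Bool, 2), by positivity,
    fun z => ?_⟩
  rw [vecNormSq_eq_sum]
  simp only [Finset.sum_mul, add_mul]
  have h1 : ∀ j s, |(z j).1 s| ≤ ‖z‖ := fun j s =>
    ((norm_le_pi_norm (z j).1 s).trans (norm_fst_le (z j))).trans (norm_le_pi_norm z j)
  have h2 : ∀ j s, |(z j).2 s| ≤ ‖z‖ := fun j s =>
    ((norm_le_pi_norm (z j).2 s).trans (norm_snd_le (z j))).trans (norm_le_pi_norm z j)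
  refine Finset.sum_le_sum fun j _ => add_le_add ?_ ?_ <;>
    refine Finset.sum_le_sum fun s _ => mul_le_mul_of_nonneg_left ?_ two_pos.le
  · exact sq_le_sq' (abs_le.1 (h1 j s)).1 (abs_le.1 (h1 j s)).2
  · exact sq_le_sq' (abs_le.1 (h2 j s)).1 (abs_le.1 (h2 j s)).2

/-- `embI` as a linear map. -/
def embILin (r n : ℕ) (k : Fin 2) : (Fin n → CD r) →ₗ[ℝ] CDCVec r n where
  toFun := embI k
  map_add' x y := by funext j; by_cases hk : k = 0 <;> simp [embI, hk]
  map_smul' c x := by funext j; by_cases hk : k = 0 <;> simp [embI, hk]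

/-- `compI` as a linear map. -/
def compILin (r n : ℕ) (k : Fin 2) : CDCVec r n →ₗ[ℝ] (Fin n → CD r) where
  toFun := compI k
  map_add' x y := by funext j; by_cases hk : k = 0 <;> simp [compI, hk]
  map_smul' c x := by funext j; by_cases hk : k = 0 <;> simp [compI, hk]

/-- `realEmb` as a linear map. -/
def realEmbLin (r n : ℕ) : (Fin n → ℝ) →ₗ[ℝ] CDCVec r n where
  toFun := realEmb r
  map_add' x y := by funext j; simp [realEmb, add_smul]
  map_smul' c x := by funext j; simp [realEmb, mul_smul]

theorem embI_compI_add (z : CDCVec r n) : embI 0 (compI 0 z) + embI 1 (compI 1 z) = z := by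
  funext j; simp [embI, compI]

theorem embI_zero_single (j : Fin n) :
    embI 0 (Pi.single j (CD.one r)) = realEmb r (Pi.single j 1) := by
  funext i
  by_cases hij : i = j
  · subst hij; simp [embI, realEmb, CDC.one]
  · simp [embI, realEmb, hij]

/-- The vector `S U_k^{1/2} e_j` (for `k = 0`) or `S 𝐢 U_k^{1/2} e_j` (for `k = 1`). -/
def column (V : Fin 2 → Lr r n n) (S : Lr r n h) (k : Fin 2) (j : Fin n) : CDCVec r h :=
  S.1 (embI k (compI 0 ((V k).1 (realEmb r (Pi.single j 1)))))

theorem column_add (V : Fin 2 → Lr r n n) (S S' : Lr r n h) (k : Fin 2) (j : Fin n) :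
    column V (S + S') k j = column V S k j + column V S' k j := rfl

theorem column_neg (V : Fin 2 → Lr r n n) (S : Lr r n h) (k : Fin 2) (j : Fin n) :
    column V (-S) k j = -column V S k j := rfl

/-- The weight 2 in `vecNormSq` on both components means that the squared norm of a column counts
the `l = 0` and `l = 1` terms of `FForm` twice. In this form every property of `FForm` reduces to
one of `vecNormSq`, because columns depend linearly on `S`. -/
theorem two_mul_FForm (V : Fin 2 → Lr r n n) (S : Lr r n h) :
    2 * FForm V S = ∑ k, ∑ j, vecNormSq (column V S k j) := by
  simp only [FForm, traceSq, embI_zero_single, Fin.sum_univ_two, Finset.mul_sum, opComp,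
    mul_add, vecNormSq]
  simp only [column, compI, Finset.sum_add_distrib]
  simp
  ring

theorem FForm_nonneg (V : Fin 2 → Lr r n n) (S : Lr r n h) : 0 ≤ FForm V S := by
  have h0 : 0 ≤ ∑ k, ∑ j, vecNormSq (column V S k j) :=
    Finset.sum_nonneg fun k _ => Finset.sum_nonneg fun j _ => vecNormSq_nonneg _
  linarith [two_mul_FForm V S]

theorem FForm_zero (V : Fin 2 → Lr r n n) : FForm V (0 : Lr r n h) = 0 := by
  have : ∑ k, ∑ j, vecNormSq (column V (0 : Lr r n h) k j) = 0 :=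
    Finset.sum_eq_zero fun k _ => Finset.sum_eq_zero fun j _ => vecNormSq_zero
  linarith [two_mul_FForm V (0 : Lr r n h)]

theorem FForm_neg (V : Fin 2 → Lr r n n) (S : Lr r n h) : FForm V (-S) = FForm V S := by
  have h1 := two_mul_FForm V S
  have h2 := two_mul_FForm V (-S)
  simp only [column_neg, vecNormSq_neg] at h2
  linarith

theorem FForm_add_le (V : Fin 2 → Lr r n n) (S S' : Lr r n h) :
    FForm V (S + S') ≤ 2 * FForm V S + 2 * FForm V S' := by
  have h1 : ∑ k, ∑ j, vecNormSq (column V (S + S') k j) ≤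
      2 * (∑ k, ∑ j, vecNormSq (column V S k j)) + 2 * ∑ k, ∑ j, vecNormSq (column V S' k j) := by
    simp only [Finset.mul_sum, ← Finset.sum_add_distrib, column_add]
    exact Finset.sum_le_sum fun k _ => Finset.sum_le_sum fun j _ => vecNormSq_add_le _ _
  rw [← two_mul_FForm, ← two_mul_FForm, ← two_mul_FForm] at h1
  linarith

theorem FForm_sub_le (V : Fin 2 → Lr r n n) (S S' : Lr r n h) :
    FForm V (S - S') ≤ 2 * FForm V S + 2 * FForm V S' := by
  have h1 := FForm_add_le V S (-S')
  rwa [FForm_neg, ← show S - S' = S + -S' from sub_eq_add_neg S S'] at h1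

theorem continuous_FForm (V : Fin 2 → Lr r n n) :
    Continuous (FForm V : Lr r n h → ℝ) := by
  have h1 : (FForm V : Lr r n h → ℝ) =
      fun S => 2⁻¹ * ∑ k, ∑ j, vecNormSq (column V S k j) := by
    funext S; linarith [two_mul_FForm V S]
  rw [h1]
  refine continuous_const.mul (continuous_finsetSum _ fun k _ => continuous_finsetSum _ fun j _ =>
    continuous_vecNormSq.comp ?_)
  exact continuous_subtype_val.clm_apply continuous_const

/-- Used to convert approximation in the operator norm into approximation in energy; this one-sided
bound suffices. -/
theorem exists_FForm_le (V : Fin 2 → Lr r n n) :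
    ∃ C : ℝ, 0 ≤ C ∧ ∀ S : Lr r n h, FForm V S ≤ C * ‖S‖ ^ 2 := by
  obtain ⟨C, hC, hCle⟩ := exists_vecNormSq_le r h
  let v : Fin 2 → Fin n → CDCVec r n := fun k j =>
    embI k (compI 0 ((V k).1 (realEmb r (Pi.single j 1))))
  refine ⟨∑ k, ∑ j, C * ‖v k j‖ ^ 2, by positivity, fun S => ?_⟩
  have h1 : ∑ k, ∑ j, vecNormSq (column V S k j) ≤ (∑ k, ∑ j, C * ‖v k j‖ ^ 2) * ‖S‖ ^ 2 := by
    simp only [Finset.sum_mul]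
    refine Finset.sum_le_sum fun k _ => Finset.sum_le_sum fun j _ => (hCle _).trans ?_
    rw [mul_assoc, ← mul_pow]
    have h2 : ‖column V S k j‖ ≤ ‖v k j‖ * ‖S‖ := by
      rw [mul_comm]; exact S.1.le_opNorm _
    gcongr
  have := FForm_nonneg V S
  linarith [two_mul_FForm V S]

end Forms

/-! ### Second moments of Gaussian vectors -/

section Gaussian

/-- The law of a centred Gaussian vector in `ℝ ^ n` with covariance matrix `v I`. -/
abbrev stdGaussian (n : ℕ) (v : ℝ≥0) : Measure (Fin n → ℝ) :=
  Measure.pi (fun _ : Fin n => gaussianReal 0 v)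

theorem gaussian_memLp_affine {n : ℕ} (v : ℝ≥0) (m : ℝ) (c : Fin n → ℝ) :
    MemLp (fun ξ => m + ∑ i, c i * ξ i) 2 (stdGaussian n v) := by
  have h1 : ∀ i, MemLp (fun ξ : Fin n → ℝ => c i * ξ i) 2 (stdGaussian n v) := fun i => by
    have h2 : MemLp (fun x : ℝ => c i * x) 2 (gaussianReal 0 v) :=
      (memLp_id_gaussianReal 2).const_mul (c i)
    exact h2.comp_measurePreserving (measurePreserving_eval _ i)
  exact (memLp_const m).add (memLp_finsetSum _ fun i _ => h1 i)

/-- Second moment equals variance plus squared mean: the mean is `m` since the coordinates are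
centred, and the variance is additive over independent coordinates. -/
theorem integral_sq_affine_gaussian {n : ℕ} (v : ℝ≥0) (m : ℝ) (c : Fin n → ℝ) :
    ∫ ξ, (m + ∑ i, c i * ξ i) ^ 2 ∂(stdGaussian n v) = m ^ 2 + v * ∑ i, c i ^ 2 := by
  have hi : ∀ i, MemLp (fun x : ℝ => c i * x) 2 (gaussianReal 0 v) := fun i =>
    (memLp_id_gaussianReal 2).const_mul (c i)
  have hL := gaussian_memLp_affine v m c
  have hvar := variance_eq_sub hL
  have h0 : MemLp (fun ξ : Fin n → ℝ => ∑ i, c i * ξ i) 2 (stdGaussian n v) := by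
    simpa using gaussian_memLp_affine v 0 c
  have h1 : Var[fun ξ : Fin n → ℝ => m + ∑ i, c i * ξ i; stdGaussian n v] =
      v * ∑ i, c i ^ 2 := by
    rw [variance_const_add h0.1]
    have h2 := variance_sum_pi hi
    have h3 : (∑ i, fun ω : Fin n → ℝ => c i * ω i) = fun ξ => ∑ i, c i * ξ i := by
      funext ξ; simp
    rw [h3] at h2
    rw [h2, Finset.mul_sum]
    refine Finset.sum_congr rfl fun i _ => ?_
    rw [variance_const_mul]
    rw [show (fun x : ℝ => x) = id from rfl, variance_id_gaussianReal]
    ring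
  have hmean : ∫ ξ, (m + ∑ i, c i * ξ i) ∂(stdGaussian n v) = m := by
    have h4 : ∀ i, ∫ ξ, c i * ξ i ∂(stdGaussian n v) = 0 := fun i => by
      rw [integral_const_mul]
      have h5 : ∫ ξ : Fin n → ℝ, ξ i ∂(stdGaussian n v) = ∫ x, x ∂(gaussianReal 0 v) := by
        rw [← (measurePreserving_eval (fun _ : Fin n => gaussianReal 0 v) i).map_eq,
          integral_map (measurable_pi_apply i).aemeasurable (by fun_prop)]
      rw [h5, integral_id_gaussianReal, mul_zero]
    have h6 : ∀ i, Integrable (fun ξ : Fin n → ℝ => c i * ξ i) (stdGaussian n v) := fun i =>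
      ((hi i).comp_measurePreserving (measurePreserving_eval _ i)).integrable one_le_two
    rw [integral_add (integrable_const _) (integrable_finsetSum _ fun i _ => h6 i),
      integral_finsetSum _ fun i _ => h6 i]
    simp [h4]
  rw [h1, hmean] at hvar
  simp only [Pi.pow_apply] at hvar
  linarith

theorem lintegral_vecNormSq_affine_gaussian {r h n : ℕ} (v : ℝ≥0) (m : CDCVec r h)
    (L : (Fin n → ℝ) →ₗ[ℝ] CDCVec r h) :
    ∫⁻ ξ, ENNReal.ofReal (vecNormSq (m + L ξ)) ∂(stdGaussian n v) =
      ENNReal.ofReal (vecNormSq m + v * ∑ i, vecNormSq (L (Pi.single i 1))) := by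
  have hL : ∀ ξ, L ξ = ∑ i, ξ i • L (Pi.single i 1) := fun ξ => by
    conv_lhs => rw [pi_eq_sum_univ' ξ]
    simp [map_sum]
  have hcoord : ∀ ξ, vecNormSq (m + L ξ) = ∑ j,
      ((∑ s, 2 * ((m j).1 s + ∑ i, (L (Pi.single i 1) j).1 s * ξ i) ^ 2) +
        ∑ s, 2 * ((m j).2 s + ∑ i, (L (Pi.single i 1) j).2 s * ξ i) ^ 2) := fun ξ => by
    rw [vecNormSq_eq_sum, hL ξ]
    simp [Finset.sum_apply, Prod.fst_sum, Prod.snd_sum, mul_comm]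
  have hi : ∀ (a : ℝ) (c : Fin n → ℝ),
      Integrable (fun ξ : Fin n → ℝ => 2 * (a + ∑ i, c i * ξ i) ^ 2) (stdGaussian n v) :=
    fun a c => (gaussian_memLp_affine v a c).integrable_sq.const_mul 2
  have hint : Integrable (fun ξ => vecNormSq (m + L ξ)) (stdGaussian n v) := by
    simp only [hcoord]
    exact integrable_finsetSum _ fun j _ =>
      (integrable_finsetSum _ fun s _ => hi _ _).add (integrable_finsetSum _ fun s _ => hi _ _)
  rw [← ofReal_integral_eq_lintegral_ofReal hint (ae_of_all _ fun ξ => vecNormSq_nonneg _)]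
  congr 1
  simp only [hcoord]
  have hadd : ∀ j, Integrable (fun ξ : Fin n → ℝ =>
      (∑ s, 2 * ((m j).1 s + ∑ i, (L (Pi.single i 1) j).1 s * ξ i) ^ 2) +
        ∑ s, 2 * ((m j).2 s + ∑ i, (L (Pi.single i 1) j).2 s * ξ i) ^ 2) (stdGaussian n v) :=
    fun j => (integrable_finsetSum _ fun s _ => hi _ _).add
      (integrable_finsetSum _ fun s _ => hi _ _)
  rw [integral_finsetSum _ fun j _ => hadd j]
  have hj : ∀ j, ∫ ξ : Fin n → ℝ,
      ((∑ s, 2 * ((m j).1 s + ∑ i, (L (Pi.single i 1) j).1 s * ξ i) ^ 2) +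
        ∑ s, 2 * ((m j).2 s + ∑ i, (L (Pi.single i 1) j).2 s * ξ i) ^ 2) ∂(stdGaussian n v) =
      (∑ s, 2 * ((m j).1 s ^ 2 + v * ∑ i, (L (Pi.single i 1) j).1 s ^ 2)) +
        ∑ s, 2 * ((m j).2 s ^ 2 + v * ∑ i, (L (Pi.single i 1) j).2 s ^ 2) := fun j => by
    rw [integral_add (integrable_finsetSum _ fun s _ => hi _ _)
        (integrable_finsetSum _ fun s _ => hi _ _),
      integral_finsetSum _ fun s _ => hi _ _, integral_finsetSum _ fun s _ => hi _ _]
    simp only [integral_const_mul, integral_sq_affine_gaussian]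
  simp only [hj, vecNormSq_eq_sum, mul_add, Finset.sum_add_distrib, Finset.mul_sum]
  have swap : ∀ f : Fin h → (Fin r → Bool) → Fin n → ℝ,
      ∑ j, ∑ s, ∑ i, f j s i = ∑ i, ∑ j, ∑ s, f j s i := fun f => by
    rw [Finset.sum_comm (s := (Finset.univ : Finset (Fin n)))]
    exact Finset.sum_congr rfl fun j _ => Finset.sum_comm
  rw [swap, swap]
  simp only [mul_left_comm (2 : ℝ) (v : ℝ)]
  ring

end Gaussian

/-! ### Isometry for one step of the driving function -/

section OneStep

variable {Ω : Type*} {mΩ : MeasurableSpace Ω} {P : Measure Ω} {T : Set ℝ} {𝓕 : Filtration T mΩ}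
  {r n h : ℕ} {U V : Fin 2 → Lr r n n} {w : T → Ω → CDCVec r n}

/-- `ξ ↦ U^{1/2} ξ` as a linear map `ℝ ^ n → 𝒜_r ^ n`, where `J = U^{1/2}`. -/
def rootLin (J : Lr r n n) : (Fin n → ℝ) →ₗ[ℝ] (Fin n → CD r) :=
  compILin r n 0 ∘ₗ J.1.toLinearMap ∘ₗ realEmbLin r n

theorem measurable_linearMap {E F : Type*} [NormedAddCommGroup E] [NormedSpace ℝ E]
    [FiniteDimensional ℝ E] [MeasurableSpace E] [BorelSpace E] [NormedAddCommGroup F]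
    [NormedSpace ℝ F] [MeasurableSpace F] [BorelSpace F] (L : E →ₗ[ℝ] F) : Measurable L :=
  L.continuous_of_finiteDimensional.measurable

/-- The increments of the two components are independent, so their joint law is the product of the
two image laws, and Tonelli gives an iterated Gaussian integral. -/
theorem IsDrivingFunction.lintegral_increment [IsProbabilityMeasure P]
    (hw : IsDrivingFunction P 𝓕 U V w) {s t : T} (hst : s < t) {g : CDCVec r n → ℝ≥0∞}
    (hg : Measurable g) :
    ∫⁻ ω, g (w t ω - w s ω) ∂P =
      ∫⁻ ξ, ∫⁻ ζ, g (embILin r n 0 (rootLin (V 0) ξ) + embILin r n 1 (rootLin (V 1) ζ))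
        ∂(stdGaussian n (Real.toNNReal ((t : ℝ) - s)))
        ∂(stdGaussian n (Real.toNNReal ((t : ℝ) - s))) := by
  set v := Real.toNNReal ((t : ℝ) - s)
  let D : Fin 2 → Ω → Fin n → CD r := fun k ω => compI k (w t ω) - compI k (w s ω)
  have hDm : ∀ k, Measurable (D k) := fun k =>
    ((hw.comp k).measurable t).sub ((hw.comp k).measurable s)
  have hind : IndepFun (D 0) (D 1) P := by
    have hφ : Measurable (fun x : T → Fin n → CD r => x t - x s) :=
      (measurable_pi_apply t).sub (measurable_pi_apply s)
    exact hw.indep_comp.comp hφ hφ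
  have hlaw : ∀ k, P.map (D k) = (stdGaussian n v).map (rootLin (V k)) := fun k =>
    (hw.comp k).law s t hst
  have hjoint := (indepFun_iff_map_prod_eq_prod_map_map (hDm 0).aemeasurable
    (hDm 1).aemeasurable).1 hind
  have hG : Measurable (fun p : (Fin n → CD r) × (Fin n → CD r) =>
      g (embILin r n 0 p.1 + embILin r n 1 p.2)) :=
    hg.comp (((measurable_linearMap _).comp measurable_fst).add
      ((measurable_linearMap _).comp measurable_snd))
  have hsum : ∀ ω, w t ω - w s ω = embILin r n 0 (D 0 ω) + embILin r n 1 (D 1 ω) := fun ω =>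
    (embI_compI_add (w t ω - w s ω)).symm
  have h1 : ∫⁻ ω, g (w t ω - w s ω) ∂P =
      ∫⁻ p, g (embILin r n 0 p.1 + embILin r n 1 p.2) ∂(P.map fun ω => (D 0 ω, D 1 ω)) := by
    rw [lintegral_map hG ((hDm 0).prodMk (hDm 1))]
    simp only [hsum]
  have hR : ∀ k, Measurable (rootLin (V k)) := fun k => measurable_linearMap _
  rw [h1, hjoint, hlaw, hlaw, Measure.map_prod_map _ _ (hR 0) (hR 1),
    lintegral_map hG ((hR 0).prodMap (hR 1))]
  exact lintegral_prod _ (hG.comp ((hR 0).prodMap (hR 1))).aemeasurable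

/-- The second moment of `m + S (w(t) - w(s))` for deterministic `m` and `S`. -/
theorem IsDrivingFunction.lintegral_vecNormSq_const [IsProbabilityMeasure P]
    (hw : IsDrivingFunction P 𝓕 U V w) {s t : T} (hst : s < t) (m : CDCVec r h) (S : Lr r n h) :
    ∫⁻ ω, ENNReal.ofReal (vecNormSq (m + S.1 (w t ω - w s ω))) ∂P =
      ENNReal.ofReal (vecNormSq m) +
        ENNReal.ofReal (2 * ((t : ℝ) - s)) * ENNReal.ofReal (FForm V S) := by
  have hv : 0 < (t : ℝ) - s := sub_pos.2 hst
  have hg : Measurable (fun x : CDCVec r n => ENNReal.ofReal (vecNormSq (m + S.1 x))) :=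
    (continuous_vecNormSq.comp (continuous_const.add S.1.continuous)).measurable.ennreal_ofReal
  rw [hw.lintegral_increment hst hg]
  -- The two Gaussian vectors are integrated out in turn: in the inner integral `m + L 0 ξ` is the
  -- constant, in the outer one `m`.
  let L : Fin 2 → (Fin n → ℝ) →ₗ[ℝ] CDCVec r h := fun k =>
    S.1.toLinearMap ∘ₗ embILin r n k ∘ₗ rootLin (V k)
  have hL : ∀ ξ ζ, m + S.1 (embILin r n 0 (rootLin (V 0) ξ) + embILin r n 1 (rootLin (V 1) ζ)) =
      (m + L 0 ξ) + L 1 ζ := fun ξ ζ => by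
    rw [map_add, add_assoc]; rfl
  simp only [hL, lintegral_vecNormSq_affine_gaussian]
  have hcol : ∀ k j, L k (Pi.single j 1) = column V S k j := fun k j => rfl
  simp only [hcol]
  have hn : ∀ k, 0 ≤ ∑ j, vecNormSq (column V S k j) := fun k =>
    Finset.sum_nonneg fun j _ => vecNormSq_nonneg _
  have hvn : (0 : ℝ) ≤ (Real.toNNReal ((t : ℝ) - s) : ℝ) := NNReal.coe_nonneg _
  simp only [ENNReal.ofReal_add (vecNormSq_nonneg _) (mul_nonneg hvn (hn _))]
  rw [lintegral_add_right _ measurable_const, lintegral_vecNormSq_affine_gaussian, lintegral_const,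
    measure_univ, mul_one, ← ENNReal.ofReal_mul (by positivity), ← ENNReal.ofReal_add
      (add_nonneg (vecNormSq_nonneg _) (mul_nonneg hvn (Finset.sum_nonneg fun _ _ =>
        vecNormSq_nonneg _))) (mul_nonneg hvn (hn _)),
    ← ENNReal.ofReal_add (vecNormSq_nonneg _)
      (mul_nonneg (by positivity) (FForm_nonneg V S))]
  congr 1
  have h2 := two_mul_FForm V S
  rw [Fin.sum_univ_two] at h2
  simp only [hcol, Real.coe_toNNReal _ hv.le]
  linear_combination -(((t : ℝ) - s) * h2)

instance Lr.continuousAdd : ContinuousAdd (Lr r n h) :=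
  inferInstanceAs (ContinuousAdd (Lr r n h).toAddSubmonoid)

instance Lr.measurableAdd₂ : MeasurableAdd₂ (Lr r n h) :=
  ⟨(Continuous.add (M := Lr r n h) continuous_fst continuous_snd).measurable⟩

theorem Lr.measurable_neg : Measurable (fun S : Lr r n h => -S) :=
  (Continuous.subtype_mk (continuous_neg.comp continuous_subtype_val) _).measurable

theorem Lr.sub_eq_add_neg (S S' : Lr r n h) : S - S' = S + -S' := _root_.sub_eq_add_neg S S'

theorem Lr.sub_self (S : Lr r n h) : S - S = 0 := _root_.sub_self S

theorem Lr.sub_zero (S : Lr r n h) : S - 0 = S := _root_.sub_zero S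

theorem Lr.neg_zero : -(0 : Lr r n h) = 0 :=
  _root_.neg_zero (G := Lr r n h)

theorem measurable_apply_Lr : Measurable (fun p : Lr r n h × CDCVec r n => p.1.1 p.2) :=
  ((continuous_subtype_val.comp continuous_fst).clm_apply continuous_snd).measurable

/-- The second moment of `M + X (w(t) - w(s))` for `𝓕_s`-measurable `M` and `X`. -/
theorem IsDrivingFunction.lintegral_vecNormSq_step [IsProbabilityMeasure P]
    (hw : IsDrivingFunction P 𝓕 U V w) {s t : T} (hst : s < t) {M : Ω → CDCVec r h}
    {X : Ω → Lr r n h} (hM : Measurable[𝓕 s] M) (hX : Measurable[𝓕 s] X) :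
    ∫⁻ ω, ENNReal.ofReal (vecNormSq (M ω + (X ω).1 (w t ω - w s ω))) ∂P =
      ∫⁻ ω, ENNReal.ofReal (vecNormSq (M ω)) ∂P +
        ENNReal.ofReal (2 * ((t : ℝ) - s)) * ∫⁻ ω, ENNReal.ofReal (FForm V (X ω)) ∂P := by
  have hM' : Measurable M := hM.mono (𝓕.le s) le_rfl
  have hX' : Measurable X := hX.mono (𝓕.le s) le_rfl
  have hwm : ∀ t, Measurable (w t) := fun t => (hw.adapted t).mono (𝓕.le t) le_rfl
  have hD : Measurable (fun ω => w t ω - w s ω) := (hwm t).sub (hwm s)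
  -- The pair must be independent of the increment jointly, not each member separately; this holds
  -- because both are `𝓕 s`-measurable.
  have hind : IndepFun (fun ω => (M ω, X ω)) (fun ω => w t ω - w s ω) P := by
    rw [IndepFun_iff_Indep]
    exact indep_of_indep_of_le_left (hw.indep_past s t hst).symm
      (Measurable.comap_le (hM.prodMk hX))
  have hjoint := (indepFun_iff_map_prod_eq_prod_map_map (hM'.prodMk hX').aemeasurable
    hD.aemeasurable).1 hind
  have hG : Measurable (fun p : (CDCVec r h × Lr r n h) × CDCVec r n =>
      ENNReal.ofReal (vecNormSq (p.1.1 + p.1.2.1 p.2))) :=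
    (continuous_vecNormSq.measurable.comp (measurable_fst.fst.add
      (measurable_apply_Lr.comp (measurable_fst.snd.prodMk measurable_snd)))).ennreal_ofReal
  have hq : Measurable (fun p : CDCVec r h × Lr r n h => ENNReal.ofReal (vecNormSq p.1)) :=
    (continuous_vecNormSq.measurable.comp measurable_fst).ennreal_ofReal
  have hF : Measurable (fun p : CDCVec r h × Lr r n h => ENNReal.ofReal (FForm V p.2)) :=
    ((continuous_FForm V).measurable.comp measurable_snd).ennreal_ofReal
  calc ∫⁻ ω, ENNReal.ofReal (vecNormSq (M ω + (X ω).1 (w t ω - w s ω))) ∂P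
      = ∫⁻ p, ENNReal.ofReal (vecNormSq (p.1.1 + p.1.2.1 p.2))
          ∂(P.map fun ω => ((M ω, X ω), w t ω - w s ω)) :=
        (lintegral_map hG ((hM'.prodMk hX').prodMk hD)).symm
    _ = ∫⁻ p, (ENNReal.ofReal (vecNormSq p.1) +
          ENNReal.ofReal (2 * ((t : ℝ) - s)) * ENNReal.ofReal (FForm V p.2))
          ∂(P.map fun ω => (M ω, X ω)) := by
        have := Measure.isProbabilityMeasure_map (μ := P) hD.aemeasurable
        -- Under the product law `M` and `X` can be frozen, which leaves the deterministic case for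
        -- each of their values.
        rw [hjoint, lintegral_prod _ hG.aemeasurable]
        refine lintegral_congr fun p => ?_
        rw [← hw.lintegral_vecNormSq_const hst]
        exact lintegral_map (hG.comp (measurable_const.prodMk measurable_id)) hD
    _ = _ := by
        refine (lintegral_map (hq.add (hF.const_mul _)) (hM'.prodMk hX')).trans ?_
        refine (lintegral_add_left (hq.comp (hM'.prodMk hX')) _).trans ?_
        exact congrArg _ (lintegral_const_mul _ (hF.comp (hM'.prodMk hX')))

/-- The isometry for sums over finitely many consecutive steps. -/
theorem IsDrivingFunction.lintegral_vecNormSq_sum [IsProbabilityMeasure P]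
    (hw : IsDrivingFunction P 𝓕 U V w) : ∀ {k : ℕ} (c : Fin (k + 1) → T), Monotone c →
    ∀ (X : Fin k → Ω → Lr r n h),
    (∀ l, c l.castSucc < c l.succ → Measurable[𝓕 (c l.castSucc)] (X l)) →
    ∫⁻ ω, ENNReal.ofReal (vecNormSq (∑ l, (X l ω).1 (w (c l.succ) ω - w (c l.castSucc) ω))) ∂P =
      ∑ l, ENNReal.ofReal (2 * ((c l.succ : ℝ) - c l.castSucc)) *
        ∫⁻ ω, ENNReal.ofReal (FForm V (X l ω)) ∂P
  | 0, c, hc, X, hX => by simp [vecNormSq_zero]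
  | k + 1, c, hc, X, hX => by
    have ih := IsDrivingFunction.lintegral_vecNormSq_sum hw (fun l : Fin (k + 1) => c l.castSucc)
      (hc.comp Fin.strictMono_castSucc.monotone) (fun l => X l.castSucc) (fun l => hX l.castSucc)
    simp only [Fin.sum_univ_castSucc (n := k)]
    simp only [Fin.castSucc_succ] at ih ⊢
    rw [← ih]
    -- A collapsed step contributes zero to both sides. Such steps arise when partition times are
    -- clipped to `[a, b]`, and for them no measurability of `X` is assumed.
    rcases (hc (Fin.castSucc_le_succ (Fin.last k))).eq_or_lt with he | hlt
    · simp [he]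
    -- The sum of the earlier steps is known at the last starting time and plays the role of `M`.
    · refine hw.lintegral_vecNormSq_step hlt ?_ (hX _ hlt)
      refine Finset.measurable_sum _ fun l _ => ?_
      have hle : c l.castSucc.succ ≤ c (Fin.last k).castSucc :=
        hc (by simp [Fin.le_def])
      rcases (hc (Fin.castSucc_le_succ l.castSucc)).eq_or_lt with he | hl
      · simp [he]
      · exact measurable_apply_Lr.comp (((hX _ hl).mono (𝓕.mono (hl.le.trans hle)) le_rfl).prodMk
          (((hw.adapted _).mono (𝓕.mono hle) le_rfl).sub
            ((hw.adapted _).mono (𝓕.mono (hl.le.trans hle)) le_rfl)))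

end OneStep

/-! ### Elementary random functions -/

section ElementaryFunctions

variable {Ω : Type*} {mΩ : MeasurableSpace Ω} {P : Measure Ω} {T : Set ℝ} {𝓕 : Filtration T mΩ}
  {r n h : ℕ} {U V : Fin 2 → Lr r n n} {w : T → Ω → CDCVec r n}

theorem sum_fin_succ_sub_castSucc {A : Type*} [AddCommGroup A] :
    ∀ {k : ℕ} (f : Fin (k + 1) → A), ∑ l : Fin k, (f l.succ - f l.castSucc) = f (Fin.last k) - f 0
  | 0, f => by simp
  | k + 1, f => by
    have ih := sum_fin_succ_sub_castSucc (fun l : Fin (k + 1) => f l.castSucc)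
    rw [Fin.sum_univ_castSucc]
    simp only [Fin.castSucc_succ, Fin.succ_last, Fin.castSucc_zero] at ih ⊢
    rw [ih]
    abel

/-- The restricted sum is the full telescoping sum of `f` composed with the clamping `l ↦ max p (min
q l)`, whose steps outside `[p, q]` vanish. -/
theorem sum_fin_ite_succ_sub_castSucc {A : Type*} [AddCommGroup A] {k : ℕ} (f : Fin (k + 1) → A)
    {p q : Fin (k + 1)} (hpq : p ≤ q) :
    ∑ l : Fin k, (if p ≤ l.castSucc ∧ l.succ ≤ q then f l.succ - f l.castSucc else 0) =
      f q - f p := by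
  have h1 : ∀ l : Fin k, (if p ≤ l.castSucc ∧ l.succ ≤ q then f l.succ - f l.castSucc else 0) =
      f (max p (min q l.succ)) - f (max p (min q l.castSucc)) := fun l => by
    have hl : l.castSucc ≤ l.succ := Fin.castSucc_le_succ l
    split_ifs with hc
    · rw [min_eq_right hc.2, min_eq_right (hl.trans hc.2), max_eq_right hc.1,
        max_eq_right (hc.1.trans hl)]
    · rcases not_and_or.1 hc with h2 | h2
      · have h3 : l.succ ≤ p := Fin.castSucc_lt_iff_succ_le.1 (not_le.1 h2)
        rw [max_eq_left ((min_le_right _ _).trans h3),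
          max_eq_left ((min_le_right _ _).trans (hl.trans h3)), sub_self]
      · have h3 : q ≤ l.castSucc := Fin.le_castSucc_iff.2 (not_le.1 h2)
        rw [min_eq_left h3, min_eq_left (h3.trans hl), sub_self]
  simp only [h1]
  rw [sum_fin_succ_sub_castSucc (fun l => f (max p (min q l)))]
  simp [hpq, Fin.le_last]

open Classical in
/-- A finite sum of random functions `X_i ch_{(u_i, v_i]}` is elementary. -/
theorem exists_elementary {z : T} (hz : (z : ℝ) = 0) (hzmin : ∀ t : T, z ≤ t) {ι : Type*}
    [Fintype ι] (u v : ι → T) (huv : ∀ i, u i < v i) (X : ι → Ω → Lr r n h)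
    (hX : ∀ i, Measurable[𝓕 (u i)] (X i)) :
    ∃ E : Elementary 𝓕 r n h,
      (∀ τ ω, E.eval τ ω = ∑ i, if u i < τ ∧ τ ≤ v i then X i ω else 0) ∧
      ∀ (w : T → Ω → CDCVec r n) (t : T) (ω : Ω), E.integralZero w t ω =
        ∑ i, (X i ω).1 (w (min (v i) t) ω - w (min (u i) t) ω) := by
  -- The common refinement: all end points together with `0`, sorted increasingly.
  let s : Finset T := insert z (Finset.univ.image u ∪ Finset.univ.image v)
  have hs : s.card = (s.card - 1) + 1 :=
    (Nat.sub_add_cancel (Finset.card_pos.2 ⟨z, Finset.mem_insert_self _ _⟩)).symm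
  set k := s.card - 1
  let time : Fin (k + 1) ↪o T := s.orderEmbOfFin hs
  have hrange : ∀ t ∈ s, ∃ p, time p = t := fun t ht => by
    have := Finset.range_orderEmbOfFin s hs
    exact (Set.ext_iff.1 this t).2 ht
  have hu : ∀ i, ∃ p, time p = u i := fun i => hrange _ (by simp [s])
  have hv : ∀ i, ∃ p, time p = v i := fun i => hrange _ (by simp [s])
  choose p hp using hu
  choose q hq using hv
  have hpq : ∀ i, p i ≤ q i := fun i => by
    rw [← time.le_iff_le, hp, hq]; exact (huv i).le
  have h0 : time 0 = z := by
    obtain ⟨p0, hp0⟩ := hrange z (Finset.mem_insert_self _ _)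
    refine le_antisymm ?_ (hzmin _)
    rw [← hp0]
    exact time.monotone (Fin.zero_le _)
  let E : Elementary 𝓕 r n h :=
    { k := k
      time := time
      time_zero := by rw [h0, hz]
      strictMono := time.strictMono
      -- On each cell the coefficient collects those `X i` whose interval contains the cell. Such an
      -- interval starts no later than the cell, hence the measurability.
      val := fun l ω => ∑ i, if p i ≤ l.castSucc ∧ l.succ ≤ q i then X i ω else 0
      measurable_val := fun l => by
        refine Finset.measurable_sum _ fun i _ => ?_
        by_cases hc : p i ≤ l.castSucc ∧ l.succ ≤ q i
        · simp only [hc, and_self, if_true]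
          exact (hX i).mono (𝓕.mono (by rw [← hp]; exact time.monotone hc.1)) le_rfl
        · simp only [hc, if_false]
          exact measurable_const }
  refine ⟨E, fun τ ω => ?_, fun w t ω => ?_⟩
  -- The indicator of a cell is the difference of the indicators of `τ ≤ t_{l+1}` and `τ ≤ t_l`, so
  -- the sum over cells telescopes for each `i`.
  · have h1 : E.eval τ ω = ∑ l : Fin k, ∑ i, if p i ≤ l.castSucc ∧ l.succ ≤ q i then
        (if τ ≤ time l.succ then X i ω else 0) - (if τ ≤ time l.castSucc then X i ω else 0)
          else 0 := by
      refine Finset.sum_congr rfl fun l _ => ?_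
      have hl : time l.castSucc < time l.succ := time.strictMono Fin.castSucc_lt_succ
      change (if time l.castSucc < τ ∧ τ ≤ time l.succ then
        ∑ i, (if p i ≤ l.castSucc ∧ l.succ ≤ q i then X i ω else 0) else 0) = _
      by_cases h1 : time l.castSucc < τ
      · by_cases h2 : τ ≤ time l.succ
        · simp [h1, h2, not_le.2 h1, Lr.sub_zero]
        · simp [h2, not_le.2 h1, Lr.sub_zero]
      · have h3 := not_lt.1 h1
        simp [h3, h1, h3.trans hl.le, Lr.sub_self]
    rw [h1, Finset.sum_comm]
    refine Finset.sum_congr rfl fun i _ => ?_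
    rw [sum_fin_ite_succ_sub_castSucc (fun l => if τ ≤ time l then X i ω else 0) (hpq i), hp, hq]
    have := huv i
    by_cases h2 : u i < τ
    · simp [h2]
    · have h3 := not_lt.1 h2
      simp [h3, h2, h3.trans this.le]
  · have h1 : E.integralZero w t ω = ∑ l : Fin k, ∑ i, if p i ≤ l.castSucc ∧ l.succ ≤ q i then
        (X i ω).1 (w (min (time l.succ) t) ω) - (X i ω).1 (w (min (time l.castSucc) t) ω)
          else 0 := by
      refine Finset.sum_congr rfl fun l _ => ?_
      change (∑ i, (if p i ≤ l.castSucc ∧ l.succ ≤ q i then X i ω else 0) : Lr r n h).1 _ = _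
      rw [Submodule.coe_sum, sum_apply]
      refine Finset.sum_congr rfl fun i _ => ?_
      split_ifs
      · rw [map_sub]
      · rfl
    rw [h1, Finset.sum_comm]
    refine Finset.sum_congr rfl fun i _ => ?_
    rw [sum_fin_ite_succ_sub_castSucc (fun l => (X i ω).1 (w (min (time l) t) ω)) (hpq i), hp, hq,
      map_sub]

/-- Differences of elementary random functions are elementary. -/
theorem exists_elementary_sub {z : T} (hz : (z : ℝ) = 0) (hzmin : ∀ t : T, z ≤ t)
    (E E' : Elementary 𝓕 r n h) : ∃ D : Elementary 𝓕 r n h,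
      (∀ τ ω, D.eval τ ω = E.eval τ ω - E'.eval τ ω) ∧
      ∀ (w : T → Ω → CDCVec r n) (a b : T) (ω : Ω),
        D.integral w a b ω = E.integral w a b ω - E'.integral w a b ω := by
  obtain ⟨D, hD1, hD2⟩ := exists_elementary (𝓕 := 𝓕) hz hzmin
    (Sum.elim (fun l => E.time l.castSucc) (fun l => E'.time l.castSucc))
    (Sum.elim (fun l => E.time l.succ) (fun l => E'.time l.succ))
    (by rintro (l | l)
        · exact E.strictMono Fin.castSucc_lt_succ
        · exact E'.strictMono Fin.castSucc_lt_succ)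
    (Sum.elim E.val fun l ω => -E'.val l ω)
    (by rintro (l | l)
        · exact E.measurable_val l
        · exact Lr.measurable_neg.comp (E'.measurable_val l))
  refine ⟨D, fun τ ω => ?_, fun w a b ω => ?_⟩
  · rw [hD1, Fintype.sum_sum_type]
    simp only [Sum.elim_inl, Sum.elim_inr, Elementary.eval]
    refine (congrArg _ ?_).trans (Lr.sub_eq_add_neg _ _).symm
    refine Eq.trans (Finset.sum_congr rfl fun l _ => ?_) (Finset.sum_neg_distrib (G := Lr r n h) _)
    by_cases hc : E'.time l.castSucc < τ ∧ τ ≤ E'.time l.succ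
    · exact (if_pos hc).trans (congrArg (fun S : Lr r n h => -S) (if_pos hc)).symm
    · exact (if_neg hc).trans
        (Lr.neg_zero.symm.trans (congrArg (fun S : Lr r n h => -S) (if_neg hc)).symm)
  · have h1 : ∀ t, D.integralZero w t ω = E.integralZero w t ω - E'.integralZero w t ω := fun t => by
      rw [hD2, Fintype.sum_sum_type, Elementary.integralZero, Elementary.integralZero,
        sub_eq_add_neg, ← Finset.sum_neg_distrib]
      rfl
    rw [Elementary.integral, Elementary.integral, Elementary.integral, h1, h1]
    abel

/-- Sums of elementary random functions are elementary. -/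
theorem exists_elementary_add {z : T} (hz : (z : ℝ) = 0) (hzmin : ∀ t : T, z ≤ t)
    (E E' : Elementary 𝓕 r n h) : ∃ D : Elementary 𝓕 r n h,
      ∀ τ ω, D.eval τ ω = E.eval τ ω + E'.eval τ ω := by
  obtain ⟨D, hD1, -⟩ := exists_elementary (𝓕 := 𝓕) hz hzmin
    (Sum.elim (fun l => E.time l.castSucc) (fun l => E'.time l.castSucc))
    (Sum.elim (fun l => E.time l.succ) (fun l => E'.time l.succ))
    (by rintro (l | l)
        · exact E.strictMono Fin.castSucc_lt_succ
        · exact E'.strictMono Fin.castSucc_lt_succ)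
    (Sum.elim E.val E'.val)
    (by rintro (l | l)
        · exact E.measurable_val l
        · exact E'.measurable_val l)
  refine ⟨D, fun τ ω => ?_⟩
  rw [hD1, Fintype.sum_sum_type]
  rfl

/-- The point of `[a, b]` closest to `t`. -/
def clip (a b t : T) : T := max a (min b t)

theorem clip_mono (a b : T) : Monotone (clip a b) := fun _ _ hst =>
  max_le_max le_rfl (min_le_min le_rfl hst)

/-- For every `t`, the increments of `w` from `min t a` to `min t b` and from `a` to `clip a b t`
agree. Hence the difference of two integrals from `0` becomes one sum over a partition of `[a, b]`.
-/
theorem Elementary.integral_eq_sum_clip (E : Elementary 𝓕 r n h) (w : T → Ω → CDCVec r n)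
    {a b : T} (hab : a ≤ b) (ω : Ω) :
    E.integral w a b ω = ∑ l : Fin E.k, (E.val l ω).1
      (w (clip a b (E.time l.succ)) ω - w (clip a b (E.time l.castSucc)) ω) := by
  have key : ∀ t, w (min t b) ω - w (min t a) ω = w (clip a b t) ω - w a ω := fun t => by
    rcases le_total t a with hta | hat
    · rw [clip, min_eq_left hta, min_eq_left (hta.trans hab), min_comm,
        min_eq_left (hta.trans hab), max_eq_left hta, sub_self, sub_self]
    · rw [clip, min_eq_right hat, min_comm b, max_eq_right (le_min hat hab)]
  rw [Elementary.integral, Elementary.integralZero, Elementary.integralZero,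
    ← Finset.sum_sub_distrib]
  refine Finset.sum_congr rfl fun l _ => ?_
  rw [← map_sub]
  congr 1
  have h1 := key (E.time l.succ)
  have h2 := key (E.time l.castSucc)
  rw [sub_sub_sub_comm, h1, h2]
  abel

theorem timeMeasure_Ioc_inter_Icc [hT : T.OrdConnected] {a b t t' : T} (hab : a ≤ b)
    (htt' : t ≤ t') :
    timeMeasure T (Ioc t t' ∩ Icc a b) =
      ENNReal.ofReal ((clip a b t' : ℝ) - clip a b t) := by
  have hTm : MeasurableSet T := hT.measurableSet
  rw [timeMeasure, (MeasurableEmbedding.subtype_coe hTm).comap_apply]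
  have h1 : Subtype.val '' (Ioc t t' ∩ Icc a b) = Ioc (t : ℝ) t' ∩ Icc (a : ℝ) b := by
    ext x
    constructor
    · rintro ⟨y, hy, rfl⟩; exact hy
    · intro hx
      exact ⟨⟨x, hT.out a.2 b.2 hx.2⟩, hx, rfl⟩
  have h2 : (Ioc (t : ℝ) t' ∩ Icc (a : ℝ) b : Set ℝ) =ᵐ[volume]
      (Ioc (t : ℝ) t' ∩ Ioc (a : ℝ) b : Set ℝ) := (ae_eq_refl _).inter Ioc_ae_eq_Icc.symm
  have hc : ∀ s : T, (clip a b s : ℝ) = max (a : ℝ) (min b s) := fun s => by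
    have hmono : Monotone (Subtype.val : T → ℝ) := fun _ _ h => h
    rw [clip, hmono.map_max, hmono.map_min]
  rw [h1, measure_congr h2, Ioc_inter_Ioc, Real.volume_Ioc, hc, hc]
  have hab' : (a : ℝ) ≤ b := hab
  have htt : (t : ℝ) ≤ t' := htt'
  rcases le_total (t' : ℝ) a with h3 | h3
  · rw [ENNReal.ofReal_of_nonpos, ENNReal.ofReal_of_nonpos]
    · simp [h3, htt.trans h3]
    · simp only [sub_nonpos]
      exact (min_le_left _ _).trans (h3.trans (le_max_right _ _))
  · rcases le_total (b : ℝ) t with h4 | h4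
    · rw [ENNReal.ofReal_of_nonpos, ENNReal.ofReal_of_nonpos]
      · simp [h4, h4.trans htt]
      · simp only [sub_nonpos]
        exact (min_le_right _ _).trans (h4.trans (le_max_left _ _))
    · rw [min_eq_right h4, max_comm, max_eq_right (le_min hab' h3), min_comm]

/-- The cells are disjoint, so at most one summand is nonzero at `τ`; this is why the quadratic form
passes through the sum. -/
theorem Elementary.ofReal_FForm_eval (E : Elementary 𝓕 r n h) (τ : T) (ω : Ω) :
    ENNReal.ofReal (FForm V (E.eval τ ω)) = ∑ l : Fin E.k,
      (Ioc (E.time l.castSucc) (E.time l.succ)).indicator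
        (fun _ => ENNReal.ofReal (FForm V (E.val l ω))) τ := by
  classical
  by_cases hex : ∃ l : Fin E.k, τ ∈ Ioc (E.time l.castSucc) (E.time l.succ)
  · obtain ⟨l, hl⟩ := hex
    have huniq : ∀ l', l' ≠ l → τ ∉ Ioc (E.time l'.castSucc) (E.time l'.succ) := fun l' hne hl' => by
      rcases lt_or_gt_of_ne hne with hlt | hlt
      · exact absurd (hl'.2.trans (E.strictMono.monotone (Fin.succ_le_castSucc_iff.2 hlt)))
          (not_le.2 hl.1)
      · exact absurd (hl.2.trans (E.strictMono.monotone (Fin.succ_le_castSucc_iff.2 hlt)))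
          (not_le.2 hl'.1)
    rw [Elementary.eval, Finset.sum_eq_single l, Finset.sum_eq_single l]
    · rw [indicator_of_mem hl]
      exact congrArg (fun S => ENNReal.ofReal (FForm V S)) (if_pos hl)
    · intro l' _ hne
      exact indicator_of_notMem (huniq l' hne) _
    · simp
    · intro l' _ hne
      exact if_neg (huniq l' hne)
    · simp
  · push Not at hex
    rw [Elementary.eval, Finset.sum_eq_zero, Finset.sum_eq_zero, FForm_zero, ENNReal.ofReal_zero]
    · exact fun l _ => indicator_of_notMem (hex l) _
    · exact fun l _ => if_neg (hex l)

theorem Elementary.energy_eval [T.OrdConnected] (E : Elementary 𝓕 r n h) {a b : T} (hab : a ≤ b) :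
    energy P V a b E.eval = ∑ l : Fin E.k,
      ENNReal.ofReal ((clip a b (E.time l.succ) : ℝ) - clip a b (E.time l.castSucc)) *
        ∫⁻ ω, ENNReal.ofReal (FForm V (E.val l ω)) ∂P := by
  have hF : ∀ l, Measurable fun ω => ENNReal.ofReal (FForm V (E.val l ω)) := fun l =>
    ((continuous_FForm V).measurable.comp
      ((E.measurable_val l).mono (𝓕.le _) le_rfl)).ennreal_ofReal
  have h1 : ∀ ω, ∫⁻ τ in Icc a b, ENNReal.ofReal (FForm V (E.eval τ ω)) ∂(timeMeasure T) =
      ∑ l : Fin E.k,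
        ENNReal.ofReal ((clip a b (E.time l.succ) : ℝ) - clip a b (E.time l.castSucc)) *
          ENNReal.ofReal (FForm V (E.val l ω)) := fun ω => by
    simp only [Elementary.ofReal_FForm_eval]
    rw [lintegral_finsetSum _ fun l _ => measurable_const.indicator measurableSet_Ioc]
    refine Finset.sum_congr rfl fun l _ => ?_
    rw [lintegral_indicator_const measurableSet_Ioc, Measure.restrict_apply measurableSet_Ioc,
      timeMeasure_Ioc_inter_Icc hab (E.strictMono Fin.castSucc_lt_succ).le, mul_comm]
  simp only [energy, h1]
  rw [lintegral_finsetSum _ fun l _ => (hF l).const_mul _]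
  exact Finset.sum_congr rfl fun l _ => lintegral_const_mul _ (hF l)

/-- The isometry for elementary random functions. -/
theorem Elementary.lintegral_vecNormSq_integral [IsProbabilityMeasure P] [T.OrdConnected]
    (hw : IsDrivingFunction P 𝓕 U V w) (E : Elementary 𝓕 r n h) {a b : T} (hab : a ≤ b) :
    ∫⁻ ω, ENNReal.ofReal (vecNormSq (E.integral w a b ω)) ∂P = 2 * energy P V a b E.eval := by
  simp only [E.integral_eq_sum_clip w hab]
  have hmono : Monotone fun l => clip a b (E.time l) := (clip_mono a b).comp E.strictMono.monotone
  rw [hw.lintegral_vecNormSq_sum (fun l => clip a b (E.time l)) hmono E.val, E.energy_eval hab,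
    Finset.mul_sum]
  · refine Finset.sum_congr rfl fun l _ => ?_
    rw [ENNReal.ofReal_mul two_pos.le, ENNReal.ofReal_ofNat, mul_assoc]
  · intro l hl
    -- Clipping moves a time to the left only if it exceeds `b`. Then both ends of the cell are
    -- clipped to the same point, contrary to `hl`; so `t_l ≤ clip a b t_l`.
    refine (E.measurable_val l).mono (𝓕.mono ?_) le_rfl
    by_contra! hcon
    rw [clip, clip] at hl
    have h1 : b < E.time l.castSucc := by
      by_contra! hb
      rw [clip, min_eq_right hb] at hcon
      exact absurd (le_max_right a _) (not_le.2 hcon)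
    have h2 : E.time l.castSucc ≤ E.time l.succ := (E.strictMono Fin.castSucc_lt_succ).le
    rw [min_eq_left h1.le, min_eq_left (h1.le.trans h2)] at hl
    exact lt_irrefl _ hl

theorem Elementary.measurable_integral (E : Elementary 𝓕 r n h)
    (hw : ∀ t, Measurable (w t)) (a b : T) : Measurable (E.integral w a b) := by
  have h1 : ∀ t, Measurable (E.integralZero w t) := fun t =>
    Finset.measurable_sum _ fun l _ => measurable_apply_Lr.comp
      (((E.measurable_val l).mono (𝓕.le _) le_rfl).prodMk ((hw _).sub (hw _)))
  exact (h1 b).sub (h1 a)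

/-- The preimage of a set under one summand is a generating rectangle, or the complement of one when
the set contains `0`. -/
theorem Elementary.measurable_eval_predSigma (E : Elementary 𝓕 r n h) :
    Measurable[predSigma 𝓕] (fun q : T × Ω => E.eval q.1 q.2) := by
  classical
  refine @Finset.measurable_sum _ _ _ _ _ _ (predSigma 𝓕) _ _ fun l _ => ?_
  have hlt : E.time l.castSucc < E.time l.succ := E.strictMono Fin.castSucc_lt_succ
  have hrect : ∀ A, MeasurableSet[𝓕 (E.time l.castSucc)] A →
      MeasurableSet[predSigma 𝓕] (Ioc (E.time l.castSucc) (E.time l.succ) ×ˢ A) := fun A hA =>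
    MeasurableSpace.measurableSet_generateFrom (Or.inl ⟨_, _, A, hlt, hA, rfl⟩)
  intro s hs
  have hA := E.measurable_val l hs
  by_cases h0 : (0 : Lr r n h) ∈ s
  · have h1 : (fun q : T × Ω => if E.time l.castSucc < q.1 ∧ q.1 ≤ E.time l.succ then
        E.val l q.2 else 0) ⁻¹' s =
        (Ioc (E.time l.castSucc) (E.time l.succ) ×ˢ (E.val l ⁻¹' s)ᶜ)ᶜ := by
      ext q
      by_cases hq : E.time l.castSucc < q.1 ∧ q.1 ≤ E.time l.succ <;> simp [hq, h0]
    rw [h1]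
    exact MeasurableSet.compl (hrect _ hA.compl)
  · have h1 : (fun q : T × Ω => if E.time l.castSucc < q.1 ∧ q.1 ≤ E.time l.succ then
        E.val l q.2 else 0) ⁻¹' s = Ioc (E.time l.castSucc) (E.time l.succ) ×ˢ (E.val l ⁻¹' s) := by
      ext q
      by_cases hq : E.time l.castSucc < q.1 ∧ q.1 ≤ E.time l.succ <;> simp [hq, h0]
    rw [h1]
    exact hrect _ hA

end ElementaryFunctions

/-! ### Approximation in `L^p` by functions built from a generating `π`-system -/

/-- The sets all of whose indicator multiples can be approximated form a Dynkin class containing the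
`π`-system, hence are all measurable sets; density of simple functions does the rest. Membership in
`𝒞` is only used up to null sets, and `Q` need only be closed under addition. -/
theorem exists_eLpNorm_sub_le_of_generateFrom {α E : Type*} [NormedAddCommGroup E]
    {m : MeasurableSpace α} {μ : Measure α} [IsFiniteMeasure μ] {𝒞 : Set (Set α)}
    (hm : m = MeasurableSpace.generateFrom 𝒞) (h𝒞 : IsPiSystem 𝒞) {p : ℝ≥0∞} (hp1 : 1 ≤ p)
    (hp : p ≠ ∞) (Q : (α → E) → Prop) (hadd : ∀ f g, Q f → Q g → Q (f + g))
    (hmeas : ∀ f, Q f → AEStronglyMeasurable f μ)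
    (hind : ∀ s ∈ 𝒞, ∀ c, ∃ g, Q g ∧ g =ᵐ[μ] s.indicator fun _ => c)
    (huniv : ∀ c, ∃ g, Q g ∧ g =ᵐ[μ] fun _ => c) {f : α → E} (hf : MemLp f p μ) {ε : ℝ≥0∞}
    (hε : ε ≠ 0) : ∃ g, eLpNorm (f - g) p μ ≤ ε ∧ Q g := by
  have hsets : ∀ s, MeasurableSet s → ∀ (c : E) (ε : ℝ≥0∞), ε ≠ 0 →
      ∃ g, eLpNorm (g - s.indicator fun _ => c) p μ ≤ ε ∧ Q g := by
    have hexact : ∀ (g s : α → E), g =ᵐ[μ] s → eLpNorm (g - s) p μ = 0 := fun g s hgs => by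
      have h1 : g - s =ᵐ[μ] 0 := by filter_upwards [hgs] with x hx; simp [hx]
      rw [eLpNorm_congr_ae h1, eLpNorm_zero]
    have hunion : ∀ s t : Set α, MeasurableSet s → MeasurableSet t → Disjoint s t →
        (∀ (c : E) (ε : ℝ≥0∞), ε ≠ 0 → ∃ g, eLpNorm (g - s.indicator fun _ => c) p μ ≤ ε ∧ Q g) →
        (∀ (c : E) (ε : ℝ≥0∞), ε ≠ 0 → ∃ g, eLpNorm (g - t.indicator fun _ => c) p μ ≤ ε ∧ Q g) →
        ∀ (c : E) (ε : ℝ≥0∞), ε ≠ 0 →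
          ∃ g, eLpNorm (g - (s ∪ t).indicator fun _ => c) p μ ≤ ε ∧ Q g := by
      intro s t hs ht hst ihs iht c ε hε
      obtain ⟨g₁, hg₁, hQ₁⟩ := ihs c (ε / 2) (by simpa using hε)
      obtain ⟨g₂, hg₂, hQ₂⟩ := iht c (ε / 2) (by simpa using hε)
      refine ⟨g₁ + g₂, ?_, hadd _ _ hQ₁ hQ₂⟩
      rw [indicator_union_of_disjoint hst]
      have h1 : (g₁ + g₂ - fun a => s.indicator (fun _ => c) a + t.indicator (fun _ => c) a) =
          (g₁ - s.indicator fun _ => c) + (g₂ - t.indicator fun _ => c) := by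
        funext x; simp only [Pi.add_apply, Pi.sub_apply]; abel
      rw [h1]
      refine (eLpNorm_add_le ((hmeas _ hQ₁).sub (aestronglyMeasurable_const.indicator hs))
        ((hmeas _ hQ₂).sub (aestronglyMeasurable_const.indicator ht)) hp1).trans ?_
      exact (add_le_add hg₁ hg₂).trans (ENNReal.add_halves ε).le
    have hempty : ∀ (c : E) (ε : ℝ≥0∞), ε ≠ 0 →
        ∃ g, eLpNorm (g - (∅ : Set α).indicator fun _ => c) p μ ≤ ε ∧ Q g := by
      intro c ε _
      obtain ⟨g, hQ, hg⟩ := huniv 0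
      refine ⟨g, ?_, hQ⟩
      rw [hexact]
      · exact zero_le
      · simpa using hg
    intro s hs
    induction s, hs using MeasurableSpace.induction_on_inter hm h𝒞 with
    | empty => exact hempty
    | basic s hs =>
      intro c ε _
      obtain ⟨g, hQ, hg⟩ := hind s hs c
      exact ⟨g, (hexact _ _ hg).le.trans zero_le, hQ⟩
    | compl s hs ih =>
      intro c ε hε
      -- The value `c` on the complement is the constant `c` plus `-c` on `s`; this is what makes
      -- constants in `Q` necessary.
      obtain ⟨g₁, hQ₁, hg₁⟩ := huniv c
      obtain ⟨g₂, hg₂, hQ₂⟩ := ih (-c) ε hε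
      refine ⟨g₁ + g₂, ?_, hadd _ _ hQ₁ hQ₂⟩
      have h1 : (g₁ + g₂ - sᶜ.indicator fun _ => c) =ᵐ[μ] g₂ - s.indicator fun _ => -c := by
        filter_upwards [hg₁] with x hx
        by_cases hxs : x ∈ s <;> simp [hx, hxs, add_comm]
      rwa [eLpNorm_congr_ae h1]
    | iUnion f hd hfm ih =>
      intro c ε hε
      have hpart : ∀ N : ℕ, ∀ (c : E) (ε : ℝ≥0∞), ε ≠ 0 →
          ∃ g, eLpNorm (g - (⋃ i < N, f i).indicator fun _ => c) p μ ≤ ε ∧ Q g := by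
        intro N
        induction N with
        | zero => simpa using hempty
        | succ N ihN =>
          rw [biUnion_lt_succ]
          refine hunion _ _ (MeasurableSet.biUnion (to_countable _) fun i _ => hfm i) (hfm N) ?_
            ihN (ih N)
          refine disjoint_iUnion₂_left.2 fun i hi => hd (ne_of_lt hi)
      -- Half of the error is spent on the tail of the union, of measure at most `η`, and half on
      -- the finite partial union.
      obtain ⟨η, hη, hηle⟩ := exists_eLpNorm_indicator_le (μ := μ) hp c (ε := ε / 2)
        (by simpa using hε)
      have htail := ENNReal.tendsto_sum_nat_add (fun i => μ (f i)) (by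
        rw [← measure_iUnion hd hfm]; exact measure_ne_top _ _)
      obtain ⟨N, hN⟩ := ((tendsto_order.1 htail).2 η (by exact_mod_cast hη)).exists
      obtain ⟨g, hg, hQ⟩ := hpart N c (ε / 2) (by simpa using hε)
      refine ⟨g, ?_, hQ⟩
      set A := ⋃ i < N, f i
      set B := ⋃ i, f i
      have hA : MeasurableSet A := MeasurableSet.biUnion (to_countable _) fun i _ => hfm i
      have hB : MeasurableSet B := MeasurableSet.iUnion hfm
      have hAB : A ⊆ B := iUnion₂_subset fun i _ => subset_iUnion f i
      have hdiff : μ (B \ A) ≤ η := by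
        refine (measure_mono ?_).trans ((measure_iUnion_le fun k => f (k + N)).trans hN.le)
        rintro x ⟨hxB, hxA⟩
        obtain ⟨i, hi⟩ := mem_iUnion.1 hxB
        have hiN : N ≤ i := by
          by_contra! hlt
          exact hxA (mem_iUnion₂.2 ⟨i, hlt, hi⟩)
        exact mem_iUnion.2 ⟨i - N, by rwa [Nat.sub_add_cancel hiN]⟩
      have h1 : (g - B.indicator fun _ => c) =
          (g - A.indicator fun _ => c) - (B \ A).indicator fun _ => c := by
        funext x
        by_cases hxA : x ∈ A
        · simp [hxA, hAB hxA]
        · by_cases hxB : x ∈ B <;> simp [hxA, hxB]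
      rw [h1]
      refine (eLpNorm_sub_le ((hmeas _ hQ).sub (aestronglyMeasurable_const.indicator hA))
        (aestronglyMeasurable_const.indicator (hB.diff hA)) hp1).trans ?_
      exact (add_le_add hg (hηle _ hdiff)).trans (ENNReal.add_halves ε).le
  exact MemLp.induction_dense hp Q (fun c s hs _ ε hε => hsets s hs c ε hε) hadd hmeas hf hε

/-! ### The energy as an integral over the product space -/

section Energy

variable {Ω : Type*} {mΩ : MeasurableSpace Ω} {P : Measure Ω} {T : Set ℝ} {𝓕 : Filtration T mΩ}
  {r n h : ℕ} {V : Fin 2 → Lr r n n} {a b : T}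

instance sigmaFinite_timeMeasure [hT : T.OrdConnected] : SigmaFinite (timeMeasure T) := by
  refine SigmaFinite.of_map _ measurable_subtype_coe.aemeasurable ?_
  rw [timeMeasure, (MeasurableEmbedding.subtype_coe hT.measurableSet).map_comap]
  infer_instance

theorem timeMeasure_Icc_lt_top [hT : T.OrdConnected] (a b : T) :
    timeMeasure T (Icc a b) < ∞ := by
  rw [timeMeasure, (MeasurableEmbedding.subtype_coe hT.measurableSet).comap_apply]
  refine (measure_mono ?_).trans_lt (measure_Icc_lt_top (a := (a : ℝ)) (b := b))
  rintro _ ⟨y, hy, rfl⟩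
  exact hy

instance isFiniteMeasure_timeMeasure_restrict [T.OrdConnected] (a b : T) :
    IsFiniteMeasure ((timeMeasure T).restrict (Icc a b)) :=
  ⟨by simpa using timeMeasure_Icc_lt_top a b⟩

/-- The product of Lebesgue measure on `[a, b]` and `P`. -/
abbrev cylMeasure (P : Measure Ω) (a b : T) : Measure (T × Ω) :=
  ((timeMeasure T).restrict (Icc a b)).prod P

theorem cylMeasure_absolutelyContinuous [SFinite P] :
    cylMeasure P a b ≪ (timeMeasure T).prod P :=
  Measure.AbsolutelyContinuous.prod Measure.absolutelyContinuous_restrict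
    Measure.AbsolutelyContinuous.rfl

theorem energy_eq_lintegral_prod [T.OrdConnected] [SFinite P] {S : T → Ω → Lr r n h}
    (hS : AEMeasurable (fun q : T × Ω => S q.1 q.2) (cylMeasure P a b)) :
    energy P V a b S = ∫⁻ q, ENNReal.ofReal (FForm V (S q.1 q.2)) ∂(cylMeasure P a b) :=
  (lintegral_prod_symm (fun q : T × Ω => ENNReal.ofReal (FForm V (S q.1 q.2)))
    ((continuous_FForm V).measurable.comp_aemeasurable hS).ennreal_ofReal).symm

theorem Lr.aemeasurable_sub {α : Type*} {m : MeasurableSpace α} {μ : Measure α}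
    {f g : α → Lr r n h} (hf : AEMeasurable f μ) (hg : AEMeasurable g μ) :
    AEMeasurable (fun x => f x - g x) μ := by
  simp only [Lr.sub_eq_add_neg]
  exact hf.add (Lr.measurable_neg.comp_aemeasurable hg)

theorem ofReal_FForm_sub_le (S S' : Lr r n h) :
    ENNReal.ofReal (FForm V (S - S')) ≤
      2 * ENNReal.ofReal (FForm V S) + 2 * ENNReal.ofReal (FForm V S') := by
  rw [← ENNReal.ofReal_ofNat, ← ENNReal.ofReal_mul two_pos.le, ← ENNReal.ofReal_mul two_pos.le,
    ← ENNReal.ofReal_add (mul_nonneg two_pos.le (FForm_nonneg V S))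
      (mul_nonneg two_pos.le (FForm_nonneg V S'))]
  exact ENNReal.ofReal_le_ofReal (FForm_sub_le V S S')

theorem Lr.sub_sub_sub_cancel_left' (X S S' : Lr r n h) : S - S' = (X - S') - (X - S) := by
  have h1 : ∀ x y z : Lr r n h, y - z = (x - z) - (x - y) := fun x y z =>
    Subtype.ext (by simp)
  exact h1 X S S'

/-- The energy of a difference is controlled by the distances to a third random function. -/
theorem energy_sub_le [T.OrdConnected] [SFinite P] {X S S' : T → Ω → Lr r n h}
    (hX : AEMeasurable (fun q : T × Ω => X q.1 q.2) (cylMeasure P a b))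
    (hS : AEMeasurable (fun q : T × Ω => S q.1 q.2) (cylMeasure P a b))
    (hS' : AEMeasurable (fun q : T × Ω => S' q.1 q.2) (cylMeasure P a b)) :
    energy P V a b (fun τ ω => S τ ω - S' τ ω) ≤
      2 * energy P V a b (fun τ ω => X τ ω - S' τ ω) +
        2 * energy P V a b (fun τ ω => X τ ω - S τ ω) := by
  have hF : ∀ {S : T → Ω → Lr r n h},
      AEMeasurable (fun q : T × Ω => S q.1 q.2) (cylMeasure P a b) →
      AEMeasurable (fun q : T × Ω => ENNReal.ofReal (FForm V (X q.1 q.2 - S q.1 q.2)))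
        (cylMeasure P a b) := fun hS =>
    ((continuous_FForm V).measurable.comp_aemeasurable (Lr.aemeasurable_sub hX hS)).ennreal_ofReal
  rw [energy_eq_lintegral_prod (Lr.aemeasurable_sub hS hS'),
    energy_eq_lintegral_prod (Lr.aemeasurable_sub hX hS'),
    energy_eq_lintegral_prod (Lr.aemeasurable_sub hX hS),
    ← lintegral_const_mul'' _ (hF hS), ← lintegral_const_mul'' _ (hF hS'),
    ← lintegral_add_left' ((hF hS').const_mul _)]
  refine lintegral_mono fun q => ?_
  dsimp only
  rw [Lr.sub_sub_sub_cancel_left' (X q.1 q.2) (S q.1 q.2) (S' q.1 q.2)]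
  exact ofReal_FForm_sub_le _ _

theorem FForm_sub_comm (S S' : Lr r n h) : FForm V (S - S') = FForm V (S' - S) := by
  rw [← FForm_neg V (S' - S), show -(S' - S) = S - S' from Subtype.ext (by simp)]

theorem ofReal_FForm_sub_le_add (S X S' : Lr r n h) :
    ENNReal.ofReal (FForm V (S - S')) ≤
      2 * ENNReal.ofReal (FForm V (S - X)) + 2 * ENNReal.ofReal (FForm V (X - S')) := by
  rw [Lr.sub_sub_sub_cancel_left' X S S', FForm_sub_comm S X, add_comm]
  exact ofReal_FForm_sub_le _ _

theorem Elementary.aemeasurable_eval (E : Elementary 𝓕 r n h) (μ : Measure (T × Ω)) :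
    AEMeasurable (fun q : T × Ω => E.eval q.1 q.2) μ :=
  (E.measurable_eval_predSigma.mono (predSigma_le 𝓕) le_rfl).aemeasurable

/-- Measurability for the completion provides a predictable function equal almost everywhere for the
product measure, hence also for its restriction to `[a, b]`. -/
theorem IsPredictable.aemeasurable [SFinite P] [T.OrdConnected] {S : T → Ω → Lr r n h}
    (hS : IsPredictable 𝓕 P S) (a b : T) :
    AEMeasurable (fun q : T × Ω => S q.1 q.2) (cylMeasure P a b) :=
  (aemeasurable_of_aemeasurable_trim (predSigma_le 𝓕)
    (NullMeasurable.aemeasurable hS)).mono_ac cylMeasure_absolutelyContinuous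

/-! ### Density of the elementary random functions -/

/-- The generators of the predictable `σ`-algebra. -/
def predictableRectangles (𝓕 : Filtration T mΩ) : Set (Set (T × Ω)) :=
  {D | ∃ (v t : T) (A : Set Ω), v < t ∧ MeasurableSet[𝓕 v] A ∧ D = Ioc v t ×ˢ A} ∪
    {D | ∃ (z : T) (A : Set Ω), (z : ℝ) = 0 ∧ MeasurableSet[𝓕 z] A ∧ D = {z} ×ˢ A}

/-- The events are intersected at the later of the two starting times, where both are measurable
since the filtration increases. If a mixed intersection is nonempty, the point lies in the interval
and the result is again a point rectangle. -/
theorem isPiSystem_predictableRectangles (𝓕 : Filtration T mΩ) :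
    IsPiSystem (predictableRectangles 𝓕) := by
  rintro D (⟨v, t, A, hvt, hA, rfl⟩ | ⟨z, A, hz, hA, rfl⟩)
    D' (⟨v', t', A', hvt', hA', rfl⟩ | ⟨z', A', hz', hA', rfl⟩) hne
  · rw [prod_inter_prod, Ioc_inter_Ioc] at hne ⊢
    obtain ⟨q, hq, -⟩ := hne
    refine Or.inl ⟨_, _, _, hq.1.trans_le hq.2, ?_, rfl⟩
    exact MeasurableSet.inter (𝓕.mono le_sup_left A hA) (𝓕.mono le_sup_right A' hA')
  · obtain ⟨q, hq, hq'⟩ := hne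
    refine Or.inr ⟨z', A ∩ A', hz', ?_, ?_⟩
    · have h1 : q.1 = z' := hq'.1
      exact MeasurableSet.inter (𝓕.mono (h1 ▸ hq.1.1.le) A hA) hA'
    · have h1 : q.1 = z' := hq'.1
      rw [prod_inter_prod, inter_eq_right.2 (singleton_subset_iff.2 (h1 ▸ hq.1))]
  · obtain ⟨q, hq, hq'⟩ := hne
    have h1 : q.1 = z := hq.1
    refine Or.inr ⟨z, A ∩ A', hz, ?_, ?_⟩
    · exact MeasurableSet.inter hA (𝓕.mono (h1 ▸ hq'.1.1.le) A' hA')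
    · rw [prod_inter_prod, inter_eq_left.2 (singleton_subset_iff.2 (h1 ▸ hq'.1))]
  · have hzz : z = z' := Subtype.ext (hz.trans hz'.symm)
    subst hzz
    exact Or.inr ⟨z, A ∩ A', hz, MeasurableSet.inter hA hA', by rw [prod_inter_prod, inter_self]⟩

theorem timeMeasure_singleton [hT : T.OrdConnected] (t : T) : timeMeasure T {t} = 0 := by
  rw [timeMeasure, (MeasurableEmbedding.subtype_coe hT.measurableSet).comap_apply]
  simp

theorem Lr.measurable_enorm : Measurable (fun S : Lr r n h => ‖S‖ₑ) :=
  (_root_.measurable_enorm (ε := CDCVec r n →L[ℝ] CDCVec r h)).comp measurable_subtype_coe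

theorem lintegral_enorm_sq_eq_eLpNorm {α E : Type*} [NormedAddCommGroup E] {m : MeasurableSpace α}
    (μ : Measure α) (f : α → E) : ∫⁻ x, ‖f x‖ₑ ^ 2 ∂μ = eLpNorm f 2 μ ^ 2 := by
  have h := eLpNorm_nnreal_pow_eq_lintegral (μ := μ) (p := 2) (f := f) two_ne_zero
  simpa using h.symm

set_option maxHeartbeats 1000000 in
/-- Bounded predictable random functions are limits of elementary ones in `L^2`. -/
theorem exists_elementary_eLpNorm_sub_le [IsProbabilityMeasure P] [T.OrdConnected] {z : T}
    (hz : (z : ℝ) = 0) (hzmin : ∀ t : T, z ≤ t) (hab : a < b) {f : T × Ω → Lr r n h}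
    (hf : Measurable[predSigma 𝓕] f) {C : ℝ} (hfC : ∀ q, ‖f q‖ ≤ C) {ε : ℝ≥0∞} (hε : ε ≠ 0) :
    ∃ E : Elementary 𝓕 r n h,
      ∫⁻ q, ‖f q - E.eval q.1 q.2‖ₑ ^ 2 ∂(cylMeasure P a b) ≤ ε := by
  classical
  let m : MeasurableSpace (T × Ω) := predSigma 𝓕
  have hm : m ≤ Prod.instMeasurableSpace := predSigma_le 𝓕
  let μ := (cylMeasure P a b).trim hm
  have hμ : @IsFiniteMeasure _ m μ := isFiniteMeasure_trim hm
  have hzm : MeasurableSet[m] (({z} : Set T) ×ˢ (univ : Set Ω)) :=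
    MeasurableSpace.measurableSet_generateFrom (Or.inr ⟨z, univ, hz, MeasurableSet.univ, rfl⟩)
  -- Elementary functions vanish at time `0`; since this slice is null, the generators `{0} × A` are
  -- harmless.
  have hμz : ∀ᵐ q ∂μ, q.1 ≠ z := by
    have h1 : μ (({z} : Set T) ×ˢ (univ : Set Ω)) = 0 := by
      rw [trim_measurableSet_eq hm hzm, Measure.prod_prod,
        Measure.restrict_apply (measurableSet_singleton z)]
      rw [measure_mono_null inter_subset_left (timeMeasure_singleton z), zero_mul]
    rw [ae_iff]
    refine measure_mono_null ?_ h1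
    intro q hq
    exact ⟨not_not.1 hq, mem_univ _⟩
  -- The measure lives on times up to `b`, so a constant on `(0, b]` represents a constant
  -- everywhere.
  have hμb : ∀ᵐ q ∂μ, q.1 ≤ b := by
    have hbm : MeasurableSet[m] (Ioc z b ×ˢ (univ : Set Ω)) :=
      MeasurableSpace.measurableSet_generateFrom
        (Or.inl ⟨z, b, univ, (hzmin a).trans_lt hab, MeasurableSet.univ, rfl⟩)
    have h1 : μ ((({z} : Set T) ×ˢ (univ : Set Ω)) ∪ Ioc z b ×ˢ (univ : Set Ω))ᶜ = 0 := by
      rw [trim_measurableSet_eq hm (hzm.union hbm).compl]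
      refine measure_mono_null (t := (Icc a b)ᶜ ×ˢ univ) ?_ ?_
      · rintro ⟨τ, ω⟩ hq
        refine ⟨fun hτ => hq ?_, mem_univ _⟩
        rcases (hzmin τ).eq_or_lt with h2 | h2
        · exact Or.inl ⟨h2.symm, mem_univ _⟩
        · exact Or.inr ⟨⟨h2, hτ.2⟩, mem_univ _⟩
      · rw [Measure.prod_prod, Measure.restrict_apply measurableSet_Icc.compl]
        simp
    rw [ae_iff]
    refine measure_mono_null ?_ h1
    rintro q hq (h2 | h2)
    · have h3 : q.1 = z := h2.1
      exact hq (h3 ▸ hzmin b)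
    · exact hq h2.1.2
  let Q : (T × Ω → Lr r n h) → Prop := fun g => ∃ E : Elementary 𝓕 r n h,
    g = fun q => E.eval q.1 q.2
  have hrect : ∀ (v t : T) (A : Set Ω) (c : Lr r n h), v < t → MeasurableSet[𝓕 v] A →
      Q ((Ioc v t ×ˢ A).indicator fun _ => c) := fun v t A c hvt hA => by
    obtain ⟨E, hE, -⟩ := exists_elementary (𝓕 := 𝓕) hz hzmin (fun _ : Unit => v) (fun _ => t)
      (fun _ => hvt) (fun _ => A.indicator fun _ => c) (fun _ => measurable_const.indicator hA)
    refine ⟨E, funext fun q => ?_⟩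
    rw [hE]
    by_cases h1 : v < q.1 ∧ q.1 ≤ t
    · by_cases h2 : q.2 ∈ A <;> simp [indicator, h1, h2]
    · simp [indicator, h1]
  have hQmeas : ∀ g, Q g → Measurable[m] g := by
    rintro g ⟨E, rfl⟩
    exact E.measurable_eval_predSigma
  have hQadd : ∀ f g, Q f → Q g → Q (f + g) := by
    rintro f g ⟨E, rfl⟩ ⟨E', rfl⟩
    obtain ⟨D, hD⟩ := exists_elementary_add hz hzmin E E'
    exact ⟨D, funext fun q => (hD q.1 q.2).symm⟩
  have hind : ∀ s ∈ predictableRectangles 𝓕, ∀ c : Lr r n h, ∃ g, Q g ∧ g =ᵐ[μ] s.indicator fun _ => c := by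
    rintro s (⟨v, t, A, hvt, hA, rfl⟩ | ⟨z', A, hz', hA, rfl⟩) c
    · exact ⟨_, hrect v t A c hvt hA, Filter.EventuallyEq.rfl⟩
    · have hzz : z' = z := Subtype.ext (hz'.trans hz.symm)
      subst hzz
      -- The empty event gives the zero function, which agrees almost everywhere with an indicator
      -- supported at time `0`.
      refine ⟨_, hrect z' b ∅ c ((hzmin a).trans_lt hab) (@MeasurableSet.empty _ (𝓕 z')), ?_⟩
      filter_upwards [hμz] with q hq
      simp [indicator, hq]
  have huniv : ∀ c : Lr r n h, ∃ g, Q g ∧ g =ᵐ[μ] fun _ => c := fun c => by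
    refine ⟨_, hrect z b univ c ((hzmin a).trans_lt hab) MeasurableSet.univ, ?_⟩
    filter_upwards [hμz, hμb] with q hq hqb
    have h1 : z < q.1 := lt_of_le_of_ne (hzmin _) (Ne.symm hq)
    simp [indicator, h1, hqb]
  have hfE : ∀ E : Elementary 𝓕 r n h, Measurable[m] fun q : T × Ω => f q - E.eval q.1 q.2 := by
    intro E
    simp only [Lr.sub_eq_add_neg]
    exact Measurable.add (m := m) hf (Lr.measurable_neg.comp E.measurable_eval_predSigma)
  have hQE : ∀ g, Q g → ∃ E : Elementary 𝓕 r n h, g = fun q => E.eval q.1 q.2 := fun g hg => hg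
  have hmeq : m = MeasurableSpace.generateFrom (predictableRectangles 𝓕) := rfl
  have hμeq : μ = (cylMeasure P a b).trim hm := rfl
  have hfm : Measurable[m] f := hf
  clear_value Q μ m
  have hfL : MemLp f 2 μ := MemLp.of_bound (Measurable.aestronglyMeasurable (m := m) hfm) C
    (ae_of_all _ hfC)
  have hε2 : ε ^ (1 / 2 : ℝ) ≠ 0 := by simp [hε]
  have hQm : ∀ g, Q g → AEStronglyMeasurable[m] g μ := fun g hg =>
    (hQmeas g hg).aestronglyMeasurable
  obtain ⟨g, hg, hQg⟩ := @exists_eLpNorm_sub_le_of_generateFrom (T × Ω) (Lr r n h) _ m μ hμ _ hmeq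
    (isPiSystem_predictableRectangles 𝓕) 2 one_le_two ENNReal.ofNat_ne_top Q hQadd hQm hind huniv
    f hfL _ hε2
  obtain ⟨E, rfl⟩ := hQE g hQg
  refine ⟨E, ?_⟩
  have htrim : ∫⁻ q, ‖f q - E.eval q.1 q.2‖ₑ ^ 2 ∂(cylMeasure P a b) =
      ∫⁻ q, ‖f q - E.eval q.1 q.2‖ₑ ^ 2 ∂μ := by
    rw [hμeq]
    exact (lintegral_trim hm ((Lr.measurable_enorm.comp (hfE E)).pow_const 2)).symm
  have hfg : (f - fun q : T × Ω => E.eval q.1 q.2) = fun q => f q - E.eval q.1 q.2 := rfl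
  rw [hfg] at hg
  rw [htrim, lintegral_enorm_sq_eq_eLpNorm μ fun q => f q - E.eval q.1 q.2]
  calc _ ≤ (ε ^ (1 / 2 : ℝ)) ^ 2 := pow_le_pow_left' hg 2
    _ = ε := by rw [← ENNReal.rpow_natCast, ← ENNReal.rpow_mul]; norm_num

end Energy

/-! ### Existence of the stochastic integral -/

section Existence

variable {Ω : Type*} {mΩ : MeasurableSpace Ω} {P : Measure Ω} {T : Set ℝ} {𝓕 : Filtration T mΩ}
  {r n h : ℕ} {U V : Fin 2 → Lr r n n} {w : T → Ω → CDCVec r n} {a b : T}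
  {S S' : T → Ω → Lr r n h}

theorem norm_le_natCast_of_enorm_le {E : Type*} [NormedAddCommGroup E] {x : E} {N : ℕ}
    (hx : ‖x‖ₑ ≤ N) : ‖x‖ ≤ N := by
  rw [← toReal_enorm]
  exact ENNReal.toReal_le_of_le_ofReal (Nat.cast_nonneg N) (by simpa using hx)

theorem ofReal_FForm_le_enorm {C : ℝ} (hC : ∀ S : Lr r n h, FForm V S ≤ C * ‖S‖ ^ 2)
    (hC0 : 0 ≤ C) (S : Lr r n h) :
    ENNReal.ofReal (FForm V S) ≤ ENNReal.ofReal C * ‖S‖ₑ ^ 2 := by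
  rw [← ofReal_norm, ← ENNReal.ofReal_pow (norm_nonneg _), ← ENNReal.ofReal_mul hC0]
  exact ENNReal.ofReal_le_ofReal (hC S)

/-- The elementary random functions are dense in `V_{2,1}`. -/
theorem MemV21.exists_elementary_energy_le [IsProbabilityMeasure P] [T.OrdConnected] {z : T}
    (hz : (z : ℝ) = 0) (hzmin : ∀ t : T, z ≤ t) (hab : a < b) (hS : MemV21 P 𝓕 V a b S)
    {ε : ℝ≥0∞} (hε : ε ≠ 0) :
    ∃ E : Elementary 𝓕 r n h, energy P V a b (fun τ ω => S τ ω - E.eval τ ω) ≤ ε := by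
  classical
  have hSae := hS.predictable.aemeasurable a b
  obtain ⟨f, hf, hSf⟩ : ∃ f : T × Ω → Lr r n h, Measurable[predSigma 𝓕] f ∧
      (fun q : T × Ω => S q.1 q.2) =ᵐ[cylMeasure P a b] f := by
    obtain ⟨f, hf, hSf⟩ := NullMeasurable.aemeasurable hS.predictable
    exact ⟨f, hf, cylMeasure_absolutelyContinuous (ae_eq_of_ae_eq_trim hSf)⟩
  have hf' : Measurable f := hf.mono (predSigma_le 𝓕) le_rfl
  -- Truncation where the operator norm exceeds `N` keeps predictability and gives boundedness.
  let g : ℕ → T × Ω → Lr r n h := fun N q => if ‖f q‖ₑ ≤ N then f q else 0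
  have hset : ∀ N : ℕ, MeasurableSet[predSigma 𝓕] {q | ‖f q‖ₑ ≤ N} := fun N =>
    (Lr.measurable_enorm.comp hf) measurableSet_Iic
  have hg : ∀ N, Measurable[predSigma 𝓕] (g N) := fun N =>
    Measurable.ite (hset N) hf measurable_const
  have hgN : ∀ N q, ‖g N q‖ ≤ N := fun N q => by
    by_cases hq : ‖f q‖ₑ ≤ N
    · simp only [g, hq, if_true]
      exact norm_le_natCast_of_enorm_le hq
    · simp only [g, hq, if_false]
      exact (norm_zero (E := Lr r n h)).le.trans (Nat.cast_nonneg N)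
  have hFm : Measurable fun S : Lr r n h => ENNReal.ofReal (FForm V S) :=
    (continuous_FForm V).measurable.ennreal_ofReal
  have hfin : ∫⁻ q, ENNReal.ofReal (FForm V (f q)) ∂(cylMeasure P a b) ≠ ∞ := by
    have h1 := hS.energy_lt_top
    rw [energy_eq_lintegral_prod hSae] at h1
    have h2 : ∫⁻ q, ENNReal.ofReal (FForm V (S q.1 q.2)) ∂(cylMeasure P a b) =
        ∫⁻ q, ENNReal.ofReal (FForm V (f q)) ∂(cylMeasure P a b) := by
      refine lintegral_congr_ae ?_
      filter_upwards [hSf] with q hq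
      rw [hq]
    exact h2 ▸ h1.ne
  have hsub : ∀ N, Measurable fun q => f q - g N q := fun N => by
    simp only [Lr.sub_eq_add_neg]
    exact hf'.add (Lr.measurable_neg.comp ((hg N).mono (predSigma_le 𝓕) le_rfl))
  have hFsub : ∀ N, Measurable fun q => ENNReal.ofReal (FForm V (f q - g N q)) := fun N =>
    hFm.comp (hsub N)
  have hlim : Tendsto (fun N => ∫⁻ q, ENNReal.ofReal (FForm V (f q - g N q)) ∂(cylMeasure P a b))
      atTop (𝓝 0) := by
    -- The difference `f - g N` is either `0` or `f`, so `FForm V f` dominates, and at each point it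
    -- is eventually `0`.
    have h1 := tendsto_lintegral_of_dominated_convergence (μ := cylMeasure P a b)
      (F := fun N q => ENNReal.ofReal (FForm V (f q - g N q))) (f := fun _ => 0)
      (fun q => ENNReal.ofReal (FForm V (f q))) hFsub (fun N => ?_) hfin ?_
    · simpa using h1
    · refine ae_of_all _ fun q => ?_
      by_cases hq : ‖f q‖ₑ ≤ N
      · simp only [g, hq, if_true, Lr.sub_self, FForm_zero]
        simp
      · simp only [g, hq, if_false, Lr.sub_zero]
        exact le_rfl
    · refine ae_of_all _ fun q => ?_
      obtain ⟨N, hN⟩ := ENNReal.exists_nat_gt (enorm_ne_top (x := f q))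
      refine tendsto_const_nhds.congr' ?_
      filter_upwards [eventually_ge_atTop N] with N' hN'
      have hq : ‖f q‖ₑ ≤ N' := hN.le.trans (by exact_mod_cast hN')
      simp only [g, hq, if_true, Lr.sub_self, FForm_zero, ENNReal.ofReal_zero]
  obtain ⟨C, hC0, hC⟩ := exists_FForm_le (h := h) V
  have hε4 : ε / 4 ≠ 0 := by simpa using hε
  obtain ⟨N, hN⟩ := ((tendsto_order.1 hlim).2 _ (pos_iff_ne_zero.2 hε4)).exists
  -- Both errors are doubled by the quadratic inequality, hence `ε / 4` each. If `C = 0` the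
  -- quotient is infinite, which does no harm, as `C` times it is still at most `ε / 4`.
  obtain ⟨E, hE⟩ := exists_elementary_eLpNorm_sub_le (P := P) hz hzmin hab (hg N) (hgN N)
    (ε := ε / 4 / ENNReal.ofReal C) (ENNReal.div_ne_zero.2 ⟨hε4, ENNReal.ofReal_ne_top⟩)
  refine ⟨E, ?_⟩
  have hEm := E.aemeasurable_eval (cylMeasure P a b)
  rw [energy_eq_lintegral_prod (Lr.aemeasurable_sub hSae hEm)]
  calc ∫⁻ q, ENNReal.ofReal (FForm V (S q.1 q.2 - E.eval q.1 q.2)) ∂(cylMeasure P a b)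
      = ∫⁻ q, ENNReal.ofReal (FForm V (f q - E.eval q.1 q.2)) ∂(cylMeasure P a b) := by
        refine lintegral_congr_ae ?_
        filter_upwards [hSf] with q hq
        rw [← hq]
    _ ≤ ∫⁻ q, (2 * ENNReal.ofReal (FForm V (f q - g N q)) +
          2 * (ENNReal.ofReal C * ‖g N q - E.eval q.1 q.2‖ₑ ^ 2)) ∂(cylMeasure P a b) := by
        refine lintegral_mono fun q => (ofReal_FForm_sub_le_add _ (g N q) _).trans ?_
        gcongr
        exact ofReal_FForm_le_enorm hC hC0 _
    _ = 2 * ∫⁻ q, ENNReal.ofReal (FForm V (f q - g N q)) ∂(cylMeasure P a b) +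
          2 * (ENNReal.ofReal C *
            ∫⁻ q, ‖g N q - E.eval q.1 q.2‖ₑ ^ 2 ∂(cylMeasure P a b)) := by
        rw [lintegral_add_left ((hFsub N).const_mul 2),
          lintegral_const_mul' _ _ ENNReal.ofNat_ne_top,
          lintegral_const_mul' _ _ ENNReal.ofNat_ne_top,
          lintegral_const_mul' _ _ ENNReal.ofReal_ne_top]
    _ ≤ 2 * (ε / 4) + 2 * (ENNReal.ofReal C * (ε / 4 / ENNReal.ofReal C)) := by
        gcongr
    _ ≤ 2 * (ε / 4) + 2 * (ε / 4) := by
        gcongr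
        exact ENNReal.mul_div_le
    _ = ε := by
        rw [← add_mul, show (2 + 2 : ℝ≥0∞) = 4 by norm_num]
        exact ENNReal.mul_div_cancel (by norm_num) (by norm_num)

theorem enorm_sq_le_ofReal_vecNormSq (z : CDCVec r h) :
    ‖z‖ₑ ^ 2 ≤ ENNReal.ofReal (vecNormSq z) := by
  rw [← ofReal_norm, ← ENNReal.ofReal_pow (norm_nonneg _)]
  exact ENNReal.ofReal_le_ofReal (norm_sq_le_vecNormSq z)

theorem eLpNorm_sq_le_lintegral_vecNormSq (f : Ω → CDCVec r h) :
    eLpNorm f 2 P ^ 2 ≤ ∫⁻ ω, ENNReal.ofReal (vecNormSq (f ω)) ∂P := by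
  rw [← lintegral_enorm_sq_eq_eLpNorm]
  exact lintegral_mono fun ω => enorm_sq_le_ofReal_vecNormSq _

/-- The isometry for differences of elementary random functions. -/
theorem Elementary.lintegral_vecNormSq_integral_sub [IsProbabilityMeasure P] [T.OrdConnected]
    (hw : IsDrivingFunction P 𝓕 U V w) {z : T} (hz : (z : ℝ) = 0) (hzmin : ∀ t : T, z ≤ t)
    (E E' : Elementary 𝓕 r n h) (hab : a ≤ b) :
    ∫⁻ ω, ENNReal.ofReal (vecNormSq (E.integral w a b ω - E'.integral w a b ω)) ∂P =
      2 * energy P V a b (fun τ ω => E.eval τ ω - E'.eval τ ω) := by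
  obtain ⟨D, hD1, hD2⟩ := exists_elementary_sub hz hzmin E E'
  have h1 := D.lintegral_vecNormSq_integral hw hab
  simp only [hD2] at h1
  rw [h1, show D.eval = fun τ ω => E.eval τ ω - E'.eval τ ω from funext₂ hD1]

/-- The isometry carries an energy-Cauchy sequence of elementary integrands to an `L^2`-Cauchy
sequence of integrals, whose limit is the required random variable. -/
theorem MemV21.exists_isStochIntegral [IsProbabilityMeasure P] [T.OrdConnected]
    (hw : IsDrivingFunction P 𝓕 U V w) {z : T} (hz : (z : ℝ) = 0) (hzmin : ∀ t : T, z ≤ t)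
    (hab : a < b) (hS : MemV21 P 𝓕 V a b S) : ∃ I, IsStochIntegral P 𝓕 V w a b S I := by
  have hwm : ∀ t, Measurable (w t) := fun t => (hw.adapted t).mono (𝓕.le t) le_rfl
  have hSae := hS.predictable.aemeasurable a b
  let B : ℕ → ℝ≥0∞ := fun κ => 2⁻¹ ^ κ
  have hB0 : ∀ κ, B κ ≠ 0 := fun κ => pow_ne_zero _ (by simp)
  have hBt : ∀ κ, B κ ≠ ∞ := fun κ => ENNReal.pow_ne_top (by simp)
  have hBanti : Antitone B := fun i j hij =>
    pow_le_pow_of_le_one zero_le (by simp) hij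
  have hBlim : Tendsto B atTop (𝓝 0) :=
    ENNReal.tendsto_pow_atTop_nhds_zero_of_lt_one (by simp)
  have hBsum : ∑' κ, B κ ≠ ∞ := by
    rw [ENNReal.tsum_geometric_two]; simp
  -- The factor 8 is the isometry's 2 times the `2 + 2` of `energy_sub_le`. The further half makes
  -- the distances strictly below the summable `B N` after taking square roots.
  choose E hE using fun κ => hS.exists_elementary_energy_le hz hzmin hab (ε := B κ ^ 2 / 2 / 8)
    (by simp [hB0 κ])
  have hdist : ∀ N i j, N ≤ i → N ≤ j →
      ∫⁻ ω, ENNReal.ofReal (vecNormSq ((E i).integral w a b ω - (E j).integral w a b ω)) ∂P ≤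
        B N ^ 2 / 2 := by
    intro N i j hi hj
    rw [Elementary.lintegral_vecNormSq_integral_sub hw hz hzmin _ _ hab.le]
    have hN : ∀ i, N ≤ i → energy P V a b (fun τ ω => S τ ω - (E i).eval τ ω) ≤
        B N ^ 2 / 2 / 8 := fun i hi => (hE i).trans (by gcongr; exact hBanti hi)
    calc _ ≤ 2 * (2 * (B N ^ 2 / 2 / 8) + 2 * (B N ^ 2 / 2 / 8)) := by
          gcongr
          refine (energy_sub_le hSae ((E i).aemeasurable_eval _)
            ((E j).aemeasurable_eval _)).trans ?_
          gcongr
          · exact hN j hj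
          · exact hN i hi
      _ = 8 * (B N ^ 2 / 2 / 8) := by ring
      _ = _ := ENNReal.mul_div_cancel (by norm_num) (by norm_num)
  -- Each `E κ` has finite energy, being at finite distance from `S`; the isometry makes its
  -- integral square integrable.
  have hmem : ∀ κ, MemLp ((E κ).integral w a b) 2 P := fun κ => by
    refine ⟨((E κ).measurable_integral hwm a b).aestronglyMeasurable, ?_⟩
    have h1 : eLpNorm ((E κ).integral w a b) 2 P ^ 2 < ∞ := by
      refine (eLpNorm_sq_le_lintegral_vecNormSq _).trans_lt ?_
      rw [(E κ).lintegral_vecNormSq_integral hw hab.le]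
      have h2 := energy_sub_le (P := P) (V := V) (a := a) (b := b) (S' := fun _ _ => 0) hSae
        ((E κ).aemeasurable_eval _) aemeasurable_const
      simp only [Lr.sub_zero] at h2
      refine ENNReal.mul_lt_top (by simp) (h2.trans_lt ?_)
      refine ENNReal.add_lt_top.2 ⟨ENNReal.mul_lt_top (by simp) hS.energy_lt_top,
        ENNReal.mul_lt_top (by simp) ((hE κ).trans_lt ?_)⟩
      exact ENNReal.div_lt_top (ENNReal.div_ne_top (ENNReal.pow_ne_top (hBt κ)) (by simp)) (by simp)
    by_contra hcon
    rw [not_lt_top_iff.1 hcon] at h1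
    simp at h1
  obtain ⟨I, hI, hIlim⟩ := Lp.cauchy_complete_eLpNorm one_le_two hmem hBsum (fun N i j hi hj => by
    refine lt_of_pow_lt_pow_left' 2 ?_
    refine ((eLpNorm_sq_le_lintegral_vecNormSq _).trans (hdist N i j hi hj)).trans_lt ?_
    exact ENNReal.half_lt_self (pow_ne_zero _ (hB0 N)) (ENNReal.pow_ne_top (hBt N)))
  have hIm := hI.1.aemeasurable
  refine ⟨hIm.mk I, hIm.measurable_mk, E, ?_, ?_⟩
  · refine tendsto_of_tendsto_of_tendsto_of_le_of_le tendsto_const_nhds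
      hBlim (fun κ => zero_le) fun κ => (hE κ).trans ?_
    have h1 : B κ ≤ 1 := pow_le_one₀ zero_le (by simp)
    calc B κ ^ 2 / 2 / 8 ≤ B κ ^ 2 := (ENNReal.div_le_of_le_mul (le_mul_of_one_le_right zero_le (by norm_num))).trans (ENNReal.half_le_self)
      _ ≤ B κ := by simpa using pow_le_pow_of_le_one zero_le h1 one_le_two
  · obtain ⟨C, hC0, hC⟩ := exists_vecNormSq_le r h
    have h1 : Tendsto (fun κ => ENNReal.ofReal C * eLpNorm ((E κ).integral w a b - I) 2 P ^ 2)
        atTop (𝓝 0) := by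
      have h2 := ENNReal.Tendsto.const_mul (a := ENNReal.ofReal C) (ENNReal.Tendsto.pow (n := 2) hIlim)
        (Or.inr ENNReal.ofReal_ne_top)
      simpa using h2
    refine tendsto_of_tendsto_of_tendsto_of_le_of_le tendsto_const_nhds h1 (fun κ => zero_le)
      fun κ => ?_
    dsimp only
    rw [← lintegral_enorm_sq_eq_eLpNorm, ← lintegral_const_mul' _ _ ENNReal.ofReal_ne_top]
    refine lintegral_mono_ae ?_
    filter_upwards [hIm.ae_eq_mk] with ω hω
    rw [← hω, ← ofReal_norm, ← ENNReal.ofReal_pow (norm_nonneg _), ← ENNReal.ofReal_mul hC0]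
    exact ENNReal.ofReal_le_ofReal (hC _)

/-- The mean square distance of two stochastic integrals is controlled by the energy of the
difference of the integrands. -/
theorem IsStochIntegral.lintegral_vecNormSq_sub_le [IsProbabilityMeasure P] [T.OrdConnected]
    (hw : IsDrivingFunction P 𝓕 U V w) {z : T} (hz : (z : ℝ) = 0) (hzmin : ∀ t : T, z ≤ t)
    (hab : a ≤ b) {I I' : Ω → CDCVec r h}
    (hS : AEMeasurable (fun q : T × Ω => S q.1 q.2) (cylMeasure P a b))
    (hS' : AEMeasurable (fun q : T × Ω => S' q.1 q.2) (cylMeasure P a b))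
    (hI : IsStochIntegral P 𝓕 V w a b S I) (hI' : IsStochIntegral P 𝓕 V w a b S' I') :
    ∫⁻ ω, ENNReal.ofReal (vecNormSq (I ω - I' ω)) ∂P ≤
      32 * energy P V a b (fun τ ω => S' τ ω - S τ ω) := by
  have hwm : ∀ t, Measurable (w t) := fun t => (hw.adapted t).mono (𝓕.le t) le_rfl
  obtain ⟨hIm, E, hE, hEI⟩ := hI
  obtain ⟨hIm', E', hE', hEI'⟩ := hI'
  set d := energy P V a b (fun τ ω => S' τ ω - S τ ω)
  set e := fun κ => energy P V a b (fun τ ω => S τ ω - (E κ).eval τ ω)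
  set e' := fun κ => energy P V a b (fun τ ω => S' τ ω - (E' κ).eval τ ω)
  set α := fun κ => ∫⁻ ω, ENNReal.ofReal (vecNormSq ((E κ).integral w a b ω - I ω)) ∂P
  set α' := fun κ => ∫⁻ ω, ENNReal.ofReal (vecNormSq ((E' κ).integral w a b ω - I' ω)) ∂P
  -- The approximating sequences of `S` and `S'` may be unrelated, so the comparison passes through
  -- `E κ` and `E' κ`. The coefficient of `d` is 4 from the pointwise bound, 2 from the isometry,
  -- and 2 from each of two uses of `energy_sub_le`; all other terms vanish in the limit.
  have hlim : Tendsto (fun κ => 2 * α κ + (4 * (2 * (2 * (2 * e' κ + 2 * d) + 2 * e κ)) + 4 * α' κ))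
      atTop (𝓝 (2 * 0 + (4 * (2 * (2 * (2 * 0 + 2 * d) + 2 * 0)) + 4 * 0))) := by
    have hm : ∀ {f : ℕ → ℝ≥0∞} {x : ℝ≥0∞} (k : ℕ), Tendsto f atTop (𝓝 x) →
        Tendsto (fun κ => (k : ℝ≥0∞) * f κ) atTop (𝓝 (k * x)) := fun k hf =>
      ENNReal.Tendsto.const_mul hf (Or.inr (ENNReal.natCast_ne_top k))
    exact (hm 2 hEI).add ((hm 4 (hm 2 ((hm 2 ((hm 2 hE').add tendsto_const_nhds)).add
      (hm 2 hE)))).add (hm 4 hEI'))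
  have h0 : 2 * 0 + (4 * (2 * (2 * (2 * 0 + 2 * d) + 2 * 0)) + 4 * 0) = 32 * d := by ring
  rw [h0] at hlim
  refine ge_of_tendsto' hlim fun κ => ?_
  have hpt : ∀ ω, ENNReal.ofReal (vecNormSq (I ω - I' ω)) ≤
      2 * ENNReal.ofReal (vecNormSq ((E κ).integral w a b ω - I ω)) +
        (4 * ENNReal.ofReal (vecNormSq ((E κ).integral w a b ω - (E' κ).integral w a b ω)) +
          4 * ENNReal.ofReal (vecNormSq ((E' κ).integral w a b ω - I' ω))) := fun ω => by
    set x := (E κ).integral w a b ω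
    set y := (E' κ).integral w a b ω
    have h1 := vecNormSq_sub_le (x - I' ω) (x - I ω)
    have h2 := vecNormSq_add_le (x - y) (y - I' ω)
    rw [sub_sub_sub_cancel_left] at h1
    rw [sub_add_sub_cancel] at h2
    have p1 := vecNormSq_nonneg (x - I ω)
    have p2 := vecNormSq_nonneg (x - y)
    have p3 := vecNormSq_nonneg (y - I' ω)
    rw [← ENNReal.ofReal_ofNat 2, ← ENNReal.ofReal_ofNat 4, ← ENNReal.ofReal_mul (by norm_num),
      ← ENNReal.ofReal_mul (by norm_num), ← ENNReal.ofReal_mul (by norm_num),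
      ← ENNReal.ofReal_add (by positivity) (by positivity),
      ← ENNReal.ofReal_add (by positivity) (by positivity)]
    exact ENNReal.ofReal_le_ofReal (by linarith)
  have hqm : ∀ {f : Ω → CDCVec r h}, Measurable f →
      Measurable fun ω => ENNReal.ofReal (vecNormSq (f ω)) := fun hf =>
    (continuous_vecNormSq.measurable.comp hf).ennreal_ofReal
  have hiE := (E κ).measurable_integral hwm a b
  have hiE' := (E' κ).measurable_integral hwm a b
  have hm₁ : Measurable fun ω => ENNReal.ofReal (vecNormSq ((E κ).integral w a b ω - I ω)) :=
    hqm (hiE.sub hIm)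
  have hm₂ : Measurable fun ω =>
      ENNReal.ofReal (vecNormSq ((E κ).integral w a b ω - (E' κ).integral w a b ω)) :=
    hqm (hiE.sub hiE')
  refine (lintegral_mono hpt).trans ?_
  rw [lintegral_add_left (hm₁.const_mul 2), lintegral_add_left (hm₂.const_mul 4),
    lintegral_const_mul' _ _ ENNReal.ofNat_ne_top, lintegral_const_mul' _ _ ENNReal.ofNat_ne_top,
    lintegral_const_mul' _ _ ENNReal.ofNat_ne_top,
    Elementary.lintegral_vecNormSq_integral_sub hw hz hzmin _ _ hab]
  gcongr
  refine (energy_sub_le hS ((E κ).aemeasurable_eval _) ((E' κ).aemeasurable_eval _)).trans ?_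
  gcongr
  exact energy_sub_le hS' hS ((E' κ).aemeasurable_eval _)

end Existence

/-! ### The indefinite integral and its stochastic continuity -/

section Indefinite

variable {Ω : Type*} {mΩ : MeasurableSpace Ω} {P : Measure Ω} {T : Set ℝ} {𝓕 : Filtration T mΩ}
  {r n h : ℕ} {U V : Fin 2 → Lr r n n} {w : T → Ω → CDCVec r n} {a b : T}
  {S : T → Ω → Lr r n h}

/-- The set is the slice at time `0`, joined with `(0, t] × Ω` when `t > 0`. -/
theorem measurableSet_predSigma_fst_le {z : T} (hz : (z : ℝ) = 0) (hzmin : ∀ t : T, z ≤ t) (t : T) :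
    MeasurableSet[predSigma 𝓕] {q : T × Ω | q.1 ≤ t} := by
  have hzm : MeasurableSet[predSigma 𝓕] (({z} : Set T) ×ˢ (univ : Set Ω)) :=
    MeasurableSpace.measurableSet_generateFrom (Or.inr ⟨z, univ, hz, MeasurableSet.univ, rfl⟩)
  rcases (hzmin t).eq_or_lt with rfl | ht
  · convert hzm using 1
    ext q
    simpa using ⟨fun h => le_antisymm h (hzmin _), fun h => h.le⟩
  · have htm : MeasurableSet[predSigma 𝓕] (Ioc z t ×ˢ (univ : Set Ω)) :=
      MeasurableSpace.measurableSet_generateFrom (Or.inl ⟨z, t, univ, ht, MeasurableSet.univ, rfl⟩)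
    convert hzm.union htm using 1
    ext q
    constructor
    · intro hq
      rcases (hzmin q.1).eq_or_lt with h1 | h1
      · exact Or.inl ⟨h1.symm, mem_univ _⟩
      · exact Or.inr ⟨⟨h1, hq⟩, mem_univ _⟩
    · rintro (h1 | h1)
      · have h2 : q.1 = z := h1.1
        exact h2.le.trans ht.le
      · exact h1.1.2

theorem FForm_ite_le (p : Prop) [Decidable p] (S : Lr r n h) :
    FForm V (if p then S else 0) ≤ FForm V S := by
  by_cases hp : p
  · simp [hp]
  · simp only [hp, if_false]
    rw [FForm_zero]
    exact FForm_nonneg V S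

-- Makes the indefinite integral a case of the integral over `[a, b]`: the cut-off is predictable
-- and can only lower `FForm`.
open Classical in
theorem MemV21.ite_le {z : T} (hz : (z : ℝ) = 0) (hzmin : ∀ t : T, z ≤ t)
    (hS : MemV21 P 𝓕 V a b S) (t : T) :
    MemV21 P 𝓕 V a b (fun τ ω => if τ ≤ t then S τ ω else 0) := by
  refine ⟨?_, lt_of_le_of_lt ?_ hS.energy_lt_top⟩
  · obtain ⟨f, hf, hSf⟩ := NullMeasurable.aemeasurable hS.predictable
    have hset := measurableSet_predSigma_fst_le (𝓕 := 𝓕) hz hzmin t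
    have hg : Measurable[predSigma 𝓕] fun q : T × Ω => if q.1 ≤ t then f q else 0 :=
      Measurable.ite hset hf measurable_const
    refine AEMeasurable.nullMeasurable ⟨_, hg, ?_⟩
    filter_upwards [hSf] with q hq
    rw [hq]
  · exact lintegral_mono fun ω => lintegral_mono fun τ =>
      ENNReal.ofReal_le_ofReal (FForm_ite_le _ _)

-- The two cut-offs differ by `S` or `-S` on the strip between `s` and `t` and agree elsewhere;
-- `FForm` is even.
open Classical in
theorem energy_ite_sub_ite_le [T.OrdConnected] [IsProbabilityMeasure P] (S : T → Ω → Lr r n h)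
    (s t : T)
    (hs : AEMeasurable (fun q : T × Ω => if q.1 ≤ s then S q.1 q.2 else 0) (cylMeasure P a b))
    (ht : AEMeasurable (fun q : T × Ω => if q.1 ≤ t then S q.1 q.2 else 0) (cylMeasure P a b)) :
    energy P V a b (fun τ ω => (if τ ≤ s then S τ ω else 0) - (if τ ≤ t then S τ ω else 0)) ≤
      ∫⁻ q in Ioc (min s t) (max s t) ×ˢ univ, ENNReal.ofReal (FForm V (S q.1 q.2))
        ∂(cylMeasure P a b) := by
  rw [energy_eq_lintegral_prod (Lr.aemeasurable_sub hs ht),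
    ← lintegral_indicator (measurableSet_Ioc.prod MeasurableSet.univ)]
  refine lintegral_mono fun q => ?_
  by_cases h1 : q.1 ≤ s <;> by_cases h2 : q.1 ≤ t
  · simp only [h1, h2, if_true, Lr.sub_self, FForm_zero, ENNReal.ofReal_zero]
    exact zero_le
  · have hq : q ∈ Ioc (min s t) (max s t) ×ˢ (univ : Set Ω) :=
      ⟨⟨min_lt_of_right_lt (not_le.1 h2), h1.trans (le_max_left _ _)⟩, mem_univ _⟩
    simp only [h1, h2, if_true, if_false, Lr.sub_zero]
    rw [indicator_of_mem hq]
  · have hq : q ∈ Ioc (min s t) (max s t) ×ˢ (univ : Set Ω) :=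
      ⟨⟨min_lt_of_left_lt (not_le.1 h1), h2.trans (le_max_right _ _)⟩, mem_univ _⟩
    simp only [h1, h2, if_true, if_false]
    rw [indicator_of_mem hq, FForm_sub_comm, Lr.sub_zero]
  · simp only [h1, h2, if_false, Lr.sub_self, FForm_zero, ENNReal.ofReal_zero]
    exact zero_le

theorem cylMeasure_Ioc_prod_univ_le [T.OrdConnected] [IsProbabilityMeasure P] {s t : T}
    (hs : s ∈ Icc a b) (ht : t ∈ Icc a b) :
    cylMeasure P a b (Ioc (min s t) (max s t) ×ˢ univ) ≤ ENNReal.ofReal |(s : ℝ) - t| := by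
  have hab : a ≤ b := hs.1.trans hs.2
  have hmono : Monotone (Subtype.val : T → ℝ) := fun _ _ h => h
  have hclip : ∀ x ∈ Icc a b, clip a b x = x := fun x hx => by
    rw [clip, min_eq_right hx.2, max_eq_right hx.1]
  rw [Measure.prod_prod, measure_univ, mul_one, Measure.restrict_apply measurableSet_Ioc,
    timeMeasure_Ioc_inter_Icc hab min_le_max,
    hclip _ ⟨hs.1.trans (le_max_left _ _), max_le hs.2 ht.2⟩,
    hclip _ ⟨le_min hs.1 ht.1, (min_le_left _ _).trans hs.2⟩, hmono.map_max, hmono.map_min,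
    max_sub_min_eq_abs, abs_sub_comm]

/-- Chebyshev's inequality. -/
theorem measure_lt_vecNorm_le {f : Ω → CDCVec r h} (hf : Measurable f) {ε : ℝ} (hε : 0 < ε) :
    P {ω | ε < vecNorm (f ω)} ≤
      (∫⁻ ω, ENNReal.ofReal (vecNormSq (f ω)) ∂P) / ENNReal.ofReal (ε ^ 2) := by
  have hm : Measurable fun ω => ENNReal.ofReal (vecNormSq (f ω)) :=
    (continuous_vecNormSq.measurable.comp hf).ennreal_ofReal
  refine (measure_mono ?_).trans (meas_ge_le_lintegral_div hm.aemeasurable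
    (by simpa using hε.ne') ENNReal.ofReal_ne_top)
  intro ω hω
  exact ENNReal.ofReal_le_ofReal ((Real.lt_sqrt hε.le).1 hω).le

theorem isStochContinuousOn_of_isIndefiniteIntegral [IsProbabilityMeasure P] [T.OrdConnected]
    (hw : IsDrivingFunction P 𝓕 U V w) {z : T} (hz : (z : ℝ) = 0) (hzmin : ∀ t : T, z ≤ t)
    (hab : a ≤ b) (hS : MemV21 P 𝓕 V a b S) {η : T → Ω → CDCVec r h}
    (hη : ∀ t ∈ Icc a b, IsIndefiniteIntegral P 𝓕 V w a b S t (η t)) :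
    IsStochContinuousOn P a b η := by
  classical
  intro t₀ ht₀ ε hε
  have hSae := hS.predictable.aemeasurable a b
  have hSt : ∀ t, AEMeasurable (fun q : T × Ω => if q.1 ≤ t then S q.1 q.2 else 0)
      (cylMeasure P a b) := fun t => by
    convert (hS.ite_le hz hzmin t).predictable.aemeasurable a b
  have hfin : ∫⁻ q, ENNReal.ofReal (FForm V (S q.1 q.2)) ∂(cylMeasure P a b) ≠ ∞ := by
    rw [← energy_eq_lintegral_prod hSae]
    exact hS.energy_lt_top.ne
  have hmeas : Tendsto (fun t => cylMeasure P a b (Ioc (min t₀ t) (max t₀ t) ×ˢ univ))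
      (𝓝[Icc a b] t₀) (𝓝 0) := by
    have h1 : Tendsto (fun t : T => ENNReal.ofReal |(t₀ : ℝ) - t|) (𝓝[Icc a b] t₀) (𝓝 0) := by
      have hc : Continuous fun t : T => ENNReal.ofReal |(t₀ : ℝ) - t| :=
        ENNReal.continuous_ofReal.comp (by fun_prop)
      have h2 := (hc.tendsto t₀).mono_left (nhdsWithin_le_nhds (s := Icc a b))
      simpa using h2
    refine tendsto_of_tendsto_of_tendsto_of_le_of_le' tendsto_const_nhds h1
      (Eventually.of_forall fun t => zero_le) ?_
    filter_upwards [self_mem_nhdsWithin] with t ht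
    exact cylMeasure_Ioc_prod_univ_le ht₀ ht
  -- Absolute continuity of the integral of `FForm V S`, which is finite on the cylinder.
  have hlim := tendsto_setLIntegral_zero hfin hmeas
  have hlim' := ENNReal.Tendsto.div_const
    (ENNReal.Tendsto.const_mul (a := 32) hlim (Or.inr ENNReal.ofNat_ne_top))
    (b := ENNReal.ofReal (ε ^ 2)) (Or.inr (by simpa using hε.ne'))
  rw [mul_zero, ENNReal.zero_div] at hlim'
  refine tendsto_of_tendsto_of_tendsto_of_le_of_le' tendsto_const_nhds hlim'
    (Eventually.of_forall fun t => zero_le) ?_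
  filter_upwards [self_mem_nhdsWithin] with t ht
  refine (measure_lt_vecNorm_le ((hη t ht).1.sub (hη t₀ ht₀).1) hε).trans ?_
  refine ENNReal.div_le_div_right ?_ _
  refine (IsStochIntegral.lintegral_vecNormSq_sub_le hw hz hzmin hab ?_ ?_ (hη t ht)
    (hη t₀ ht₀)).trans ?_
  · convert hSt t
  · convert hSt t₀
  · gcongr
    convert energy_ite_sub_ite_le S t₀ t (hSt t₀) (hSt t)

end Indefinite

end CDStoch
end

/-! ### Existence and stochastic continuity for `T = [0, s]` or `T = [0, ∞)` -/

open CDStoch in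
theorem theorem2p27 {Ω : Type*} {mΩ : MeasurableSpace Ω} (P : Measure Ω) [IsProbabilityMeasure P]
    (r n h : ℕ) (hr : 2 ≤ r)
    (T : Set ℝ) (hT : (∃ s : ℝ, 0 < s ∧ T = Set.Icc 0 s) ∨ T = Set.Ici 0)
    (𝓕 : Filtration T mΩ) (h𝓕 : IsNormalFiltration 𝓕 P)
    (U V : Fin 2 → Lr r n n) (w : T → Ω → CDCVec r n) (hw : IsDrivingFunction P 𝓕 U V w)
    (a b : T) (hab : a < b)
    (S : T → Ω → Lr r n h) (hS : MemV21 P 𝓕 V a b S) :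
    (∀ t ∈ Set.Icc a b, ∃ I : Ω → CDCVec r h, IsIndefiniteIntegral P 𝓕 V w a b S t I) ∧
    ∀ η : T → Ω → CDCVec r h,
      (∀ t ∈ Set.Icc a b, IsIndefiniteIntegral P 𝓕 V w a b S t (η t)) →
        IsStochContinuousOn P a b η := by
  -- Both forms of `T` enter only as an order-connected set with least element `0`.
  have hconn : T.OrdConnected := by
    rcases hT with ⟨s, -, rfl⟩ | rfl
    · exact Set.ordConnected_Icc
    · exact Set.ordConnected_Ici
  obtain ⟨z, hz, hzmin⟩ : ∃ z : T, (z : ℝ) = 0 ∧ ∀ t : T, z ≤ t := by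
    rcases hT with ⟨s, hs, rfl⟩ | rfl
    · exact ⟨⟨0, le_rfl, hs.le⟩, rfl, fun t => t.2.1⟩
    · exact ⟨⟨0, Set.mem_Ici.2 le_rfl⟩, rfl, fun t => t.2⟩
  exact ⟨fun t _ => (hS.ite_le hz hzmin t).exists_isStochIntegral hw hz hzmin hab,
    fun η hη => isStochContinuousOn_of_isIndefiniteIntegral hw hz hzmin hab.le hS hη⟩
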